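/- Let $m\le p<n$, $A\in\mathbb R^{n\times n}$, $B\in\mathbb R^{n\times m}$, $C\in\mathbb R^{p\times n}$, and consider the plant $\dot x=Ax+B(u+f)$, $y=Cx$, with switching function $s=Hy$, where $H\in\mathbb R^{m\times p}$ has full rank and $HCB$ is invertible. Let $M\in\mathbb R^{(n-m)\times n}$ have full rank with $MB=0$, let $P_1=\begin{bmatrix}M\\HC\end{bmatrix}$, partition $P_1^{-1}=[Q\;\;R]$ with $Q$ having $n-m$ columns, put $\xi=Mx$, and assume that the reduced-order motion $\dot\xi=A_c\xi$, $A_c=MAQ$, is stable, i.e. all eigenvalues of $A_c$ have negative real part. For a sampling period $T>0$ put $\Phi=e^{AT}$, $\Gamma=\int_0^Te^{A\tau}d\tau\,B$, $\bar A=(\Phi-I_n)/T$, $\bar B=\Gamma/T$, $\Omega_2=HC\bar AR$, and consider the sampled-data system $$x[k+1]=\Phi x[k]+\Gamma u[k]+d[k],\qquad d[k]=\int_0^Te^{A\tau}Bf((k+1)T-\tau)\,d\tau,\qquad s[k]=HCx[k],\qquad k\ge 0,$$ under the output feedback law, for $k\ge2$, $$u[k]=-\tfrac1T(HC\bar B)^{-1}\big(((3-\alpha)I_m+T\Omega_2)s[k]-(3I_m+2T\Omega_2)s[k-1]+(I_m+T\Omega_2)s[k-2]\big)+2u[k-1]-u[k-2],$$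 where $u[0],u[1]$ are given initial inputs, and $\alpha\in(0,1)$ satisfies $\beta_0\le(1-\alpha)/T\le\beta_1$ for given constants $0<\beta_0\le\beta_1$. Let $D$ be given; the disturbances considered are the functions $f:[0,\infty)\to\mathbb R^m$ that are twice differentiable with $\|f\|,\|\dot f\|,\|\ddot f\|\le D$. Then there is $T_{\max}>0$, depending only on the matrices and on $\beta_0,\beta_1,D$, such that $HC\bar B$ is invertible for all $T\in(0,T_{\max}]$ and the following hold. (1) There is a constant $K>0$, depending only on the matrices and on $\beta_0,\beta_1,D$, such that for all $T\in(0,T_{\max}]$, all such $\alpha$ and all $\rho$ there is $N$ such that, for every such disturbance $f$ and every closed-loop trajectory with $\|\xi[0]\|,\|s[0]\|,\|u[0]\|,\|u[1]\|\le\rho$, $$\|s[k]\|\le KT^2\quad\text{and}\quad\|x[k]\|\le KT\qquad\text{for all }k\ge N.$$ That is, there is a quasi-sliding motion with an $O(T^2)$ boundary layer, and the state has an $O(T)$ ultimate bound. (2) For every $\rho$ there is a constant $L>0$ such that for all $T\in(0,T_{\max}]$, all such $\alpha$, every such $f$ and every closed-loop trajectory with $\|\xi[0]\|,\|s[0]\|,\|u[0]\|,\|u[1]\|\le\rho$,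 one has $\|u[k]\|\le L$ for all $k\ge0$. That is, the control input is $O(1)$ when the initial data are $O(1)$. -/

import Mathlib

open scoped Matrix

noncomputable section

/-- The data of the problem: the plant `ẋ = A x + B (u + f)`, `y = C x` with state dimension
`n = q + m`, input dimension `m` and output dimension `p`, the switching matrix `H`
(switching function `s = H y`), and the matrix `M` of the change of coordinates `ξ = M x`. -/
structure SMCData (q m p : ℕ) where
  A : Matrix (Fin (q + m)) (Fin (q + m)) ℝ
  B : Matrix (Fin (q + m)) (Fin m) ℝ
  C : Matrix (Fin p) (Fin (q + m)) ℝ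
  H : Matrix (Fin m) (Fin p) ℝ
  M : Matrix (Fin q) (Fin (q + m)) ℝ

namespace SMCData

variable {q m p : ℕ} (S : SMCData q m p)

/-- The transformation matrix `P₁`, with `M` stacked on top of `H C`. -/
def P1 : Matrix (Fin (q + m)) (Fin (q + m)) ℝ :=
  (Matrix.fromRows S.M (S.H * S.C)).submatrix finSumFinEquiv.symm id

/-- The first `q = n - m` columns of `P₁⁻¹`. -/
def Q : Matrix (Fin (q + m)) (Fin q) ℝ := (S.P1⁻¹).submatrix id (Fin.castAdd m)

/-- The last `m` columns of `P₁⁻¹`. -/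
def R : Matrix (Fin (q + m)) (Fin m) ℝ := (S.P1⁻¹).submatrix id (Fin.natAdd q)

/-- The matrix `A_c = M A Q` of the reduced-order (sliding) motion `ξ̇ = A_c ξ`. -/
def Ac : Matrix (Fin q) (Fin q) ℝ := S.M * S.A * S.Q

/-- `Φ = e^{AT}`. -/
def Phi (T : ℝ) : Matrix (Fin (q + m)) (Fin (q + m)) ℝ := NormedSpace.exp (T • S.A)

/-- `Γ = (∫₀ᵀ e^{Aτ} dτ) B`, the integral being taken entrywise. -/
def Gam (T : ℝ) : Matrix (Fin (q + m)) (Fin m) ℝ :=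
  (Matrix.of fun i j => ∫ τ in (0 : ℝ)..T, NormedSpace.exp (τ • S.A) i j) * S.B

/-- `Ā = (Φ - I) / T`. -/
def Abar (T : ℝ) : Matrix (Fin (q + m)) (Fin (q + m)) ℝ := T⁻¹ • (S.Phi T - 1)

/-- `B̄ = Γ / T`. -/
def Bbar (T : ℝ) : Matrix (Fin (q + m)) (Fin m) ℝ := T⁻¹ • S.Gam T

/-- `Ω₂ = H C Ā R`. -/
def Omega2 (T : ℝ) : Matrix (Fin m) (Fin m) ℝ := S.H * S.C * S.Abar T * S.R

/-- The sampled disturbance `d[k] = ∫₀ᵀ e^{Aτ} B f((k+1)T - τ) dτ`. -/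
def dist (f : ℝ → Fin m → ℝ) (T : ℝ) (k : ℕ) : Fin (q + m) → ℝ :=
  ∫ τ in (0 : ℝ)..T, (NormedSpace.exp (τ • S.A) * S.B) *ᵥ f (((k : ℝ) + 1) * T - τ)

/-- The value of the switching function `s = H y = H C x` at the state `x`. -/
def switching (x : Fin (q + m) → ℝ) : Fin m → ℝ := S.H *ᵥ (S.C *ᵥ x)

/-- `H` is a legitimate sliding surface design: it has full rank, `H C B` is invertible and the
reduced-order motion is stable (all eigenvalues of `A_c` have negative real part); and the rows
of `M` are linearly independent and annihilate `B`. -/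
structure IsDesign : Prop where
  rank_H : S.H.rank = m
  isUnit_HCB : IsUnit (S.H * S.C * S.B)
  mul_B : S.M * S.B = 0
  rank_M : S.M.rank = q
  stable : ∀ z ∈ spectrum ℂ (S.Ac.map (algebraMap ℝ ℂ)), z.re < 0

/-- `(x, u)` is a trajectory of the sampled-data system
`x[k+1] = Φ x[k] + Γ u[k] + d[k]` in closed loop with the output feedback law
`u[k] = -(1/T)(H C B̄)⁻¹ (((3-α)I + TΩ₂) s[k] - (3I + 2TΩ₂) s[k-1] + (I + TΩ₂) s[k-2])
  + 2 u[k-1] - u[k-2]`.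
The law needs two past samples, so it acts from `k = 2` on; `u[0]` and `u[1]` are initial data. -/
structure IsClosedLoop (f : ℝ → Fin m → ℝ) (T α : ℝ)
    (x : ℕ → Fin (q + m) → ℝ) (u : ℕ → Fin m → ℝ) : Prop where
  state : ∀ k, x (k + 1) = S.Phi T *ᵥ x k + S.Gam T *ᵥ u k + S.dist f T k
  control : ∀ k, u (k + 2) =
    -(T⁻¹ • ((S.H * S.C * S.Bbar T)⁻¹ *ᵥ
        (((3 - α) • (1 : Matrix (Fin m) (Fin m) ℝ) + T • S.Omega2 T) *ᵥ S.switching (x (k + 2))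
          - ((3 : ℝ) • (1 : Matrix (Fin m) (Fin m) ℝ) + (2 * T) • S.Omega2 T) *ᵥ
              S.switching (x (k + 1))
          + ((1 : Matrix (Fin m) (Fin m) ℝ) + T • S.Omega2 T) *ᵥ S.switching (x k))))
      + (2 : ℝ) • u (k + 1) - u k

/-- The initial data `ξ[0] = M x[0]`, `s[0]`, `u[0]`, `u[1]` are bounded by `ρ`. -/
structure InitBound (ρ : ℝ) (x : ℕ → Fin (q + m) → ℝ) (u : ℕ → Fin m → ℝ) : Prop where
  xi_zero : ‖S.M *ᵥ x 0‖ ≤ ρ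
  s_zero : ‖S.switching (x 0)‖ ≤ ρ
  u_zero : ‖u 0‖ ≤ ρ
  u_one : ‖u 1‖ ≤ ρ

end SMCData

/-- The disturbance `f` is twice differentiable on `[0, ∞)`, and `f`, its first derivative and its
second derivative are bounded by `D` there. -/
def DisturbanceBound {m : ℕ} (D : ℝ) (f : ℝ → Fin m → ℝ) : Prop :=
  ∃ v w : ℝ → Fin m → ℝ, ∀ t, 0 ≤ t →
    HasDerivWithinAt f (v t) (Set.Ici 0) t ∧ HasDerivWithinAt v (w t) (Set.Ici 0) t ∧
    ‖f t‖ ≤ D ∧ ‖v t‖ ≤ D ∧ ‖w t‖ ≤ D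

/-- The admissible sampling periods and design parameters: `0 < T ≤ Tmax`, `0 < α < 1`, and
`β = (1 - α) / T` lies between `β₀` and `β₁`. -/
structure Admissible (β₀ β₁ Tmax T α : ℝ) : Prop where
  T_pos : 0 < T
  T_le : T ≤ Tmax
  α_pos : 0 < α
  α_lt_one : α < 1
  β_ge : β₀ ≤ (1 - α) / T
  β_le : (1 - α) / T ≤ β₁

end

/-!
Put `e[k] = T • (H C Ā Q) ξ[k] + H C d[k]`. Since `x = Q ξ + R s`, the plant reads
`s[k+1] = (I + T Ω₂) s[k] + e[k] + T (H C B̄) u[k]`, and the control law is such that in closed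
loop the perturbation is replaced by its second difference:
`s[k+1] = α s[k] + (e[k] - 2 e[k-1] + e[k-2])` (`IsClosedLoop.switching_recursion`), while
`u[k] = -(H C B̄)⁻¹ ((β + Ω₂) s[k] + (2 e[k-1] - e[k-2]) / T)` with `β = (1 - α) / T`
(`IsClosedLoop.control_eq`); because `e[k] = O(T)`, the input stays `O(1)`.

The reduced state satisfies `ξ[k+1] = (I + T A_c) ξ[k] + T (M Ā R) s[k] + O(T²)`, since `M B = 0`
makes both `M B̄ = O(T)` and `M d[k] = O(T²)`. As `A_c` is stable, for one small `t` the matrix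
`I + t A_c` has spectral radius below one; Gelfand's formula gives an equivalent norm `V` which it
contracts, and since `I + T A_c` is for `T ≤ t` a convex combination of `I` and `I + t A_c`, it
contracts `V` by a factor `1 - c T` (`exists_adapted_norm`).

Second differences of the sampled disturbance are `O(T³)`, and increments of `ξ` are
`T · O(‖ξ‖ + ‖s‖ + T)`. So `V(ξ)`, `‖s‖` and `‖u‖` obey a system of scalar delay inequalities
(`SMCData.exists_delayIneq`) in which `‖s‖` drives `V(ξ)` with gain `O(1)` and `V(ξ)` drives `‖s‖`
with gain `O(T)`. For small `T` the loop gain is small, and a discrete Halanay inequality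
(`delay_decay`) applied to `max (V ξ) (Λ ‖s‖)` bounds both uniformly in `T`, with ultimate bound
`O(T)`. Then `ξ` moves by `O(T²)` per step, so `s` is driven by `O(T³)` while contracting at rate
`1 - β₀ T`, which leaves `s = O(T²)` (`DelayIneq.exists_ultimate_bound`).
-/

/-! ### Scalar delay inequalities -/

/-- A discrete Halanay inequality: a sequence contracting at rate `1 - c T` up to a delayed term
of relative size `c T / 4` and a constant forcing `g` decays geometrically to `2 g / (c T)`.
The delay is at most four steps, and the delayed term enters through an upper bound `b` of the
window `y (k - 4), …, y k`. -/
theorem delay_decay {y : ℕ → ℝ} {c T g Y : ℝ} (hc : 0 < c) (hT : 0 < T) (hcT : c * T ≤ 1 / 4)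
    (hY : 0 ≤ Y) (hg : 0 ≤ g) (h0 : ∀ k ≤ 4, y k ≤ Y)
    (h : ∀ k, 4 ≤ k → ∀ b, (∀ j ≤ 4, y (k - j) ≤ b) →
      y (k + 1) ≤ (1 - c * T) * y k + c / 4 * T * b + g) (k : ℕ) :
    y k ≤ 2 * Y * (1 - c * T / 4) ^ k + 2 * g / (c * T) := by
  have hh : 0 < c * T := mul_pos hc hT
  obtain ⟨θ, hθ⟩ : ∃ θ, θ = 1 - c * T / 4 := ⟨_, rfl⟩
  obtain ⟨G, hG⟩ : ∃ G, G = 2 * g / (c * T) := ⟨_, rfl⟩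
  have hGg : c * T * G = 2 * g := by rw [hG]; field_simp
  have hG0 : 0 ≤ G := by rw [hG]; positivity
  have hθ0 : 15 / 16 ≤ θ := by linarith
  have hθ1 : θ ≤ 1 := by linarith
  have hθ4 : 1 / 2 ≤ θ ^ 4 := by
    have := pow_le_pow_left₀ (by norm_num) hθ0 4
    norm_num at this; linarith
  rw [← hθ, ← hG]
  induction k using Nat.strong_induction_on with
  | _ k ih =>
  rcases Nat.lt_or_ge k 5 with hk | hk
  · have h1 : θ ^ 4 ≤ θ ^ k := pow_le_pow_of_le_one (by linarith) hθ1 (by omega)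
    have := h0 k (by omega)
    nlinarith
  · obtain ⟨n, rfl⟩ : ∃ n, k = n + 4 + 1 := ⟨k - 5, by omega⟩
    have hp : 0 ≤ θ ^ n := pow_nonneg (by linarith) n
    have h1 := h (n + 4) (by omega) (2 * Y * θ ^ n + G) (by
      intro j hj
      refine (ih (n + 4 - j) (by omega)).trans ?_
      have := pow_le_pow_of_le_one (by linarith : 0 ≤ θ) hθ1 (by omega : n ≤ n + 4 - j)
      have := mul_le_mul_of_nonneg_left this (by linarith : 0 ≤ 2 * Y)
      linarith)
    have h2 := mul_le_mul_of_nonneg_left (ih (n + 4) (by omega)) (by linarith : 0 ≤ 1 - c * T)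
    have e1 : θ ^ (n + 4) = θ ^ n * θ ^ 4 := pow_add _ _ _
    have e2 : θ ^ (n + 4 + 1) = θ ^ n * θ ^ 4 * θ := by rw [pow_succ, e1]
    rw [e2]
    rw [e1] at h2
    have key : 0 ≤ (Y * θ ^ n * (c * T)) * (θ ^ 4 * (3 / 2) - 1 / 2) :=
      mul_nonneg (by positivity) (by linarith)
    have e3 : 2 * Y * (θ ^ n * θ ^ 4 * θ) =
      2 * Y * (θ ^ n * θ ^ 4) - Y * θ ^ n * (c * T) * θ ^ 4 / 2 := by
      rw [hθ]; ring
    rw [e3]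
    nlinarith [h1, h2, key, hGg]

/-- The scalar inequalities satisfied along a closed-loop trajectory by `a = V ξ`, `σ = ‖s‖` and
`μ = ‖u‖`, for the contraction rate `c`, the coupling constant `C`, the sampling period `T` and the
disturbance bound `D`. No bound for `μ 0` and `μ 1` is part of it. -/
structure DelayIneq (c C T D : ℝ) (a σ μ : ℕ → ℝ) : Prop where
  a_nonneg : ∀ k, 0 ≤ a k
  σ_nonneg : ∀ k, 0 ≤ σ k
  input : ∀ k, μ (k + 2) ≤ C * (σ (k + 2) + a (k + 1) + a k + D)
  slow : ∀ k, a (k + 1) ≤ (1 - c * T) * a k + C * T * σ k + C * T ^ 2 * (a k + σ k + μ k + D)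
  sliding : ∀ k, σ (k + 3) ≤ (1 - c * T) * σ (k + 2)
    + C * T ^ 2 * (a (k + 1) + a k + σ (k + 1) + σ k) + C * T ^ 3 * (μ (k + 1) + μ k + D)

/-- Uniformly in small `T`, both `a` and `σ` decay geometrically to `O(T)`. The weight `Λ` on `σ`
makes the `O(1)` coupling from `σ` to `a` small; the coupling back is `O(T)`. -/
theorem DelayIneq.exists_decay {c C : ℝ} (hc : 0 < c) (hC : 0 < C) :
    ∃ T₁ K : ℝ, 0 < T₁ ∧ 0 < K ∧ T₁ ≤ 1 ∧ c * T₁ ≤ 1 / 4 ∧ ∀ T, 0 < T → T ≤ T₁ →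
      ∀ (D Y : ℝ) (a σ μ : ℕ → ℝ), 0 < D → 0 ≤ Y → DelayIneq c C T D a σ μ →
      (∀ k ≤ 4, a k ≤ Y ∧ σ k ≤ Y) →
      ∀ k, a k ≤ K * Y * (1 - c * T / 4) ^ k + K * T * D ∧
        σ k ≤ K * Y * (1 - c * T / 4) ^ k + K * T * D := by
  -- the weight is chosen so that `C ≤ (c / 8) * Λ`
  obtain ⟨Λ, hΛ⟩ : ∃ Λ, Λ = 1 + 8 * C / c := ⟨_, rfl⟩
  have hΛ1 : 1 ≤ Λ := by rw [hΛ]; linarith [show 0 < 8 * C / c by positivity]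
  have hΛ0 : 0 < Λ := by linarith
  have hCΛ : C ≤ c / 8 * Λ := by rw [hΛ]; field_simp; nlinarith
  obtain ⟨E, hE⟩ : ∃ E, E = Λ * C * (4 + 6 * C) := ⟨_, rfl⟩
  have hE0 : 0 < E := by rw [hE]; positivity
  obtain ⟨F, hF⟩ : ∃ F, F = Λ * C * (2 * C + 1) := ⟨_, rfl⟩
  have hF0 : 0 < F := by rw [hF]; positivity
  refine ⟨min 1 (min (1 / (4 * c)) (c / (8 * E))), 2 * Λ + 2 * F / c, by positivity,
    by positivity, min_le_left _ _, ?_, ?_⟩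
  · have : min 1 (min (1 / (4 * c)) (c / (8 * E))) ≤ 1 / (4 * c) :=
      (min_le_right _ _).trans (min_le_left _ _)
    calc _ ≤ c * (1 / (4 * c)) := by gcongr
      _ = 1 / 4 := by field_simp
  intro T hT hTle D Y a σ μ hD hY hs hinit
  have hT1 : T ≤ 1 := hTle.trans (min_le_left _ _)
  have hcT : c * T ≤ 1 / 4 := by
    have : T ≤ 1 / (4 * c) := hTle.trans ((min_le_right _ _).trans (min_le_left _ _))
    calc _ ≤ c * (1 / (4 * c)) := by gcongr
      _ = 1 / 4 := by field_simp
  have hET : E * T ≤ c / 8 := by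
    have : T ≤ c / (8 * E) := hTle.trans ((min_le_right _ _).trans (min_le_right _ _))
    calc _ ≤ E * (c / (8 * E)) := by gcongr
      _ = c / 8 := by field_simp
  have hmain := delay_decay (y := fun k => max (a k) (Λ * σ k)) (g := F * T ^ 2 * D)
    (Y := Λ * Y) hc hT hcT (by positivity) (by positivity) ?_ ?_
  · intro k
    have hk := hmain k
    have hθ : 0 ≤ (1 - c * T / 4) ^ k := pow_nonneg (by linarith) k
    have e : 2 * (F * T ^ 2 * D) / (c * T) = 2 * F / c * T * D := by field_simp
    rw [e] at hk
    have hb : 2 * (Λ * Y) * (1 - c * T / 4) ^ k + 2 * F / c * T * D ≤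
        (2 * Λ + 2 * F / c) * Y * (1 - c * T / 4) ^ k + (2 * Λ + 2 * F / c) * T * D := by
      have h1 : 0 ≤ 2 * F / c * Y * (1 - c * T / 4) ^ k := by positivity
      have h2 : 0 ≤ 2 * Λ * T * D := by positivity
      nlinarith
    have h1 := (le_max_left _ _).trans (hk.trans hb)
    have h2 := (le_max_right _ _).trans (hk.trans hb)
    have h3 : σ k ≤ Λ * σ k := le_mul_of_one_le_left (hs.σ_nonneg k) hΛ1
    exact ⟨h1, h3.trans h2⟩
  · intro k hk
    obtain ⟨h1, h2⟩ := hinit k hk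
    refine max_le (h1.trans (le_mul_of_one_le_left hY hΛ1)) (by gcongr)
  · intro k hk b hb
    obtain ⟨n, rfl⟩ : ∃ n, k = n + 4 := ⟨k - 4, by omega⟩
    have ha : ∀ j ≤ 4, a (n + j) ≤ b := by
      intro j hj
      have := (le_max_left _ _).trans (hb (4 - j) (by omega))
      rwa [show n + 4 - (4 - j) = n + j by omega] at this
    have hσ : ∀ j ≤ 4, Λ * σ (n + j) ≤ b := by
      intro j hj
      have := (le_max_right _ _).trans (hb (4 - j) (by omega))
      rwa [show n + 4 - (4 - j) = n + j by omega] at this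
    have hσ' : ∀ j ≤ 4, σ (n + j) ≤ b := fun j hj =>
      (le_mul_of_one_le_left (hs.σ_nonneg _) hΛ1).trans (hσ j hj)
    have hb0 : 0 ≤ b := (hs.a_nonneg n).trans (ha 0 (by omega))
    have hμ : ∀ j ≤ 2, μ (n + j + 2) ≤ C * (3 * b + D) := by
      intro j hj
      refine (hs.input (n + j)).trans ?_
      have := ha j (by omega)
      have := ha (j + 1) (by omega)
      have := hσ' (j + 2) (by omega)
      rw [add_assoc n j, add_assoc n j]
      gcongr
      linarith
    refine max_le ?_ ?_
    · have h1 := hs.slow (n + 4)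
      have h2 := hμ 2 le_rfl
      have h3 := ha 4 le_rfl
      have h4 := hσ' 4 le_rfl
      have h5 : (1 - c * T) * a (n + 4) ≤ (1 - c * T) * max (a (n + 4)) (Λ * σ (n + 4)) :=
        mul_le_mul_of_nonneg_left (le_max_left _ _) (by linarith)
      have h6 : C * T * σ (n + 4) ≤ c / 8 * T * b := by
        calc C * T * σ (n + 4) ≤ (c / 8 * Λ) * T * σ (n + 4) := by
              have := hs.σ_nonneg (n + 4); gcongr
          _ = c / 8 * T * (Λ * σ (n + 4)) := by ring
          _ ≤ _ := by have := hσ 4 le_rfl; gcongr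
      have h7 : C * T ^ 2 * (a (n + 4) + σ (n + 4) + μ (n + 4) + D) ≤
          c / 8 * T * b + F * T ^ 2 * D := by
        calc _ ≤ C * T ^ 2 * (b + b + C * (3 * b + D) + D) := by gcongr
          _ = (1 * C * (2 + 3 * C) * T) * T * b + (1 * C * (C + 1)) * T ^ 2 * D := by ring
          _ ≤ (Λ * C * (4 + 6 * C) * T) * T * b + (Λ * C * (2 * C + 1)) * T ^ 2 * D := by
              gcongr <;> linarith
          _ ≤ _ := by rw [← hE, ← hF]; gcongr
      linarith
    · have h1 := hs.sliding (n + 2)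
      have h20 := hμ 0 (by omega)
      have h21 := hμ 1 (by omega)
      have h5 : (1 - c * T) * (Λ * σ (n + 4)) ≤ (1 - c * T) * max (a (n + 4)) (Λ * σ (n + 4)) :=
        mul_le_mul_of_nonneg_left (le_max_right _ _) (by linarith)
      have h7 : Λ * (C * T ^ 2 * (a (n + 3) + a (n + 2) + σ (n + 3) + σ (n + 2))
          + C * T ^ 3 * (μ (n + 3) + μ (n + 2) + D)) ≤ c / 4 * T * b + F * T ^ 2 * D := by
        have := ha 3 (by omega)
        have := ha 2 (by omega)
        have := hσ' 3 (by omega)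
        have := hσ' 2 (by omega)
        calc _ ≤ Λ * (C * T ^ 2 * (b + b + b + b)
              + C * T ^ 2 * (C * (3 * b + D) + C * (3 * b + D) + D)) := by
              have e : C * T ^ 3 * (μ (n + 3) + μ (n + 2) + D) ≤
                C * T ^ 2 * (C * (3 * b + D) + C * (3 * b + D) + D) := by
                calc _ ≤ C * T ^ 3 * (C * (3 * b + D) + C * (3 * b + D) + D) := by
                      gcongr
                  _ ≤ _ := by
                      have : T ^ 3 ≤ T ^ 2 := pow_le_pow_of_le_one hT.le hT1 (by norm_num)
                      gcongr
              gcongr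
          _ = (Λ * C * (4 + 6 * C) * T) * T * b + (Λ * C * (2 * C + 1)) * T ^ 2 * D := by ring
          _ ≤ _ := by
              rw [← hE, ← hF]
              have : E * T ≤ c / 4 := by linarith
              gcongr
      have h8 := mul_le_mul_of_nonneg_left h1 hΛ0.le
      simp only [add_assoc, Nat.reduceAdd] at h8 h7 h5 ⊢
      linarith

/-- Bounds for `a` and `σ` uniform in small `T`, and the ultimate bounds `a = O(T)`,
`σ = O(T ^ 2)`: once `a` and `σ` are `O(T)`, the sequence `σ` is forced only by `O(T ^ 3)`. The
index `N` depends on the initial bound `Y`, not on the sequences. -/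
theorem DelayIneq.exists_ultimate_bound {c C : ℝ} (hc : 0 < c) (hC : 0 < C) :
    ∃ T₁ K : ℝ, 0 < T₁ ∧ 0 < K ∧ T₁ ≤ 1 ∧ ∀ T, 0 < T → T ≤ T₁ →
      ∀ D Y : ℝ, 0 < D → 0 ≤ Y →
      (∀ a σ μ : ℕ → ℝ, DelayIneq c C T D a σ μ → (∀ k ≤ 4, a k ≤ Y ∧ σ k ≤ Y) →
        ∀ k, a k ≤ K * (Y + D) ∧ σ k ≤ K * (Y + D)) ∧
      ∃ N : ℕ, ∀ a σ μ : ℕ → ℝ, DelayIneq c C T D a σ μ → (∀ k ≤ 4, a k ≤ Y ∧ σ k ≤ Y) →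
        ∀ k, N ≤ k → a k ≤ K * T * D ∧ σ k ≤ K * T ^ 2 * D := by
  obtain ⟨T₁, K, hT₁, hK, hT₁1, hcT₁, hdec⟩ := DelayIneq.exists_decay hc hC
  obtain ⟨K₃, hK₃⟩ : ∃ K₃, K₃ = C * (4 * (K + 1) + 2 * (C * (3 * (K + 1) + 1)) + 1) := ⟨_, rfl⟩
  have hK₃0 : 0 < K₃ := by rw [hK₃]; positivity
  refine ⟨T₁, (K + 1) + 2 * K₃ / c, hT₁, by positivity, hT₁1, ?_⟩
  intro T hT hTle D Y hD hY
  have hT1 : T ≤ 1 := hTle.trans hT₁1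
  have hcT : c * T ≤ 1 / 4 := le_trans (by gcongr) hcT₁
  have hcT0 : 0 < c * T := mul_pos hc hT
  have hK₃c : 0 < 2 * K₃ / c := by positivity
  refine ⟨?_, ?_⟩
  · intro a σ μ hs hinit k
    have hb : K * Y * (1 - c * T / 4) ^ k + K * T * D ≤ ((K + 1) + 2 * K₃ / c) * (Y + D) := by
      have h1 : (1 - c * T / 4) ^ k ≤ 1 := pow_le_one₀ (by linarith) (by linarith)
      calc _ ≤ K * Y * 1 + K * 1 * D := by gcongr
        _ = K * (Y + D) := by ring
        _ ≤ _ := by gcongr; linarith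
    obtain ⟨h1, h2⟩ := hdec T hT hTle D Y a σ μ hD hY hs hinit k
    exact ⟨h1.trans hb, h2.trans hb⟩
  have hsmall : ∀ A ε : ℝ, 0 < ε → ∃ N, ∀ k, N ≤ k → A * (1 - c * T / 4) ^ k ≤ ε := by
    intro A ε hε
    have := (tendsto_pow_atTop_nhds_zero_of_lt_one (by linarith : 0 ≤ 1 - c * T / 4)
      (by linarith)).const_mul A
    rw [mul_zero] at this
    obtain ⟨N, hN⟩ := Filter.eventually_atTop.1 (this.eventually_le_const hε)
    exact ⟨N, hN⟩
  -- after `N₀` steps the transient is below the ultimate bound `O(T)` of both sequences, and after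
  -- `N₁` further steps the transient of `σ`, restarted at size `O(T)`, is below `T ^ 2 * D`
  obtain ⟨N₀, hN₀⟩ := hsmall (K * Y) (T * D) (by positivity)
  obtain ⟨N₁, hN₁⟩ := hsmall (2 * ((K + 1) * T * D)) (T ^ 2 * D) (by positivity)
  refine ⟨N₀ + 4 + N₁, ?_⟩
  intro a σ μ hs hinit
  have hfar : ∀ k, N₀ ≤ k → a k ≤ (K + 1) * T * D ∧ σ k ≤ (K + 1) * T * D := by
    intro k hk
    obtain ⟨h1, h2⟩ := hdec T hT hTle D Y a σ μ hD hY hs hinit k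
    have := hN₀ k hk
    constructor <;> linarith
  have hμ : ∀ k, N₀ ≤ k → μ (k + 2) ≤ C * (3 * (K + 1) + 1) * D := by
    intro k hk
    have h1 := (hfar k hk).1
    have h2 := (hfar (k + 1) (by omega)).1
    have h3 := (hfar (k + 2) (by omega)).2
    have h4 : (K + 1) * T * D ≤ (K + 1) * D := by
      have : (K + 1) * T ≤ (K + 1) * 1 := by gcongr
      nlinarith
    calc _ ≤ _ := hs.input k
      _ ≤ C * ((3 * (K + 1) + 1) * D) := by gcongr; linarith
      _ = _ := by ring
  have hσ := delay_decay (y := fun k => σ (N₀ + 4 + k)) (g := K₃ * T ^ 3 * D)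
    (Y := (K + 1) * T * D) hc hT hcT (by positivity) (by positivity) ?_ ?_
  · intro k hk
    refine ⟨(hfar k (by omega)).1.trans ?_, ?_⟩
    · have : 0 ≤ 2 * K₃ / c * T * D := by positivity
      linarith
    · obtain ⟨j, rfl⟩ : ∃ j, k = N₀ + 4 + j := ⟨k - (N₀ + 4), by omega⟩
      have h1 := hσ j
      have h2 := hN₁ j (by omega)
      have e : 2 * (K₃ * T ^ 3 * D) / (c * T) = 2 * K₃ / c * T ^ 2 * D := by field_simp
      simp only [e] at h1
      have h3 : 0 ≤ K * T ^ 2 * D := by positivity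
      linarith
  · intro k _
    exact (hfar _ (by omega)).2
  · intro k _ b hb
    have hb0 : 0 ≤ b := (hs.σ_nonneg _).trans (hb 0 (by omega))
    have h1 := hs.sliding (N₀ + 2 + k)
    have h20 := hμ (N₀ + k) (by omega)
    have h21 := hμ (N₀ + k + 1) (by omega)
    have ha0 := hfar (N₀ + 2 + k) (by omega)
    have ha1 := hfar (N₀ + 2 + k + 1) (by omega)
    have e1 : N₀ + 4 + (k + 1) = N₀ + 2 + k + 3 := by omega
    have e2 : N₀ + 4 + k = N₀ + 2 + k + 2 := by omega
    have e3 : N₀ + k + 1 + 2 = N₀ + 2 + k + 1 := by omega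
    have e4 : N₀ + k + 2 = N₀ + 2 + k := by omega
    rw [e3] at h21
    rw [e4] at h20
    simp only [e1, e2]
    have h3 : C * T ^ 2 * (a (N₀ + 2 + k + 1) + a (N₀ + 2 + k) + σ (N₀ + 2 + k + 1)
        + σ (N₀ + 2 + k)) ≤ C * T ^ 2 * (4 * ((K + 1) * T * D)) := by gcongr; linarith
    have h4 : C * T ^ 3 * (μ (N₀ + 2 + k + 1) + μ (N₀ + 2 + k) + D) ≤
        C * T ^ 3 * (2 * (C * (3 * (K + 1) + 1) * D) + D) := by gcongr; linarith
    have h5 : 0 ≤ c / 4 * T * b := by positivity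
    have h6 : C * T ^ 2 * (4 * ((K + 1) * T * D)) +
        C * T ^ 3 * (2 * (C * (3 * (K + 1) + 1) * D) + D) = K₃ * T ^ 3 * D := by rw [hK₃]; ring
    linarith

/-- Over finitely many steps, `z = ‖x‖` and `μ = ‖u‖` are bounded in terms of the initial data. The
control law bounds `μ` only from index two on, so `μ 0` and `μ 1` are data. -/
theorem exists_initial_bound {C R D : ℝ} (hC : 0 ≤ C) (hR : 0 ≤ R) (hD : 0 ≤ D) (n : ℕ) :
    ∃ Y : ℝ, 0 ≤ Y ∧ ∀ z μ : ℕ → ℝ, (∀ k, z (k + 1) ≤ C * (z k + μ k + D)) →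
      (∀ k, μ (k + 2) ≤ C * (z (k + 2) + z (k + 1) + z k + D)) →
      z 0 ≤ R → μ 0 ≤ R → μ 1 ≤ R → ∀ k ≤ n, z k ≤ Y ∧ μ k ≤ Y := by
  induction n with
  | zero =>
    refine ⟨R, hR, fun z μ _ _ h0 h1 _ k hk => ?_⟩
    obtain rfl : k = 0 := by omega
    exact ⟨h0, h1⟩
  | succ n ih =>
    obtain ⟨Y, hY, h⟩ := ih
    have hZ : 0 ≤ C * (Y + Y + D) := by positivity
    refine ⟨Y + R + C * (Y + Y + D) + C * (C * (Y + Y + D) + Y + Y + D), by positivity, ?_⟩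
    intro z μ hz hμ z0 μ0 μ1 k hk
    have hb := h z μ hz hμ z0 μ0 μ1
    have hV : 0 ≤ C * (C * (Y + Y + D) + Y + Y + D) := by positivity
    rcases Nat.lt_or_ge k (n + 1) with h1 | h1
    · obtain ⟨h2, h3⟩ := hb k (by omega)
      constructor <;> linarith
    · obtain rfl : k = n + 1 := by omega
      obtain ⟨h2, h3⟩ := hb n le_rfl
      have h4 : z (n + 1) ≤ C * (Y + Y + D) := (hz n).trans (by gcongr)
      refine ⟨by linarith, ?_⟩
      rcases n with _ | n
      · simp only [zero_add]; linarith
      · have := (hb n (by omega)).1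
        have h5 : μ (n + 2) ≤ C * (C * (Y + Y + D) + Y + Y + D) :=
          (hμ n).trans (by gcongr)
        exact h5.trans (by linarith)

/-! ### Matrix exponential and sampled disturbance -/

section MatrixNorm

open Set

attribute [local instance] Matrix.linftyOpNormedAddCommGroup Matrix.linftyOpNormedSpace
  Matrix.linftyOpNormedRing Matrix.linftyOpNormedAlgebra

theorem continuous_exp_smul {n : ℕ} (A : Matrix (Fin n) (Fin n) ℝ) :
    Continuous fun τ : ℝ => NormedSpace.exp (τ • A) :=
  continuous_iff_continuousAt.2 fun t => (hasDerivAt_exp_smul_const (𝕂 := ℝ) A t).continuousAt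

/-- Taylor estimates of order zero, one and two for `exp (τ A)` on `[0, 1]`. -/
theorem exp_smul_estimates {n : ℕ} (A : Matrix (Fin n) (Fin n) ℝ) :
    ∃ C : ℝ, 0 < C ∧ ∀ τ ∈ Icc (0 : ℝ) 1, ‖NormedSpace.exp (τ • A)‖ ≤ C ∧
      ‖NormedSpace.exp (τ • A) - 1‖ ≤ C * τ ∧
      ‖NormedSpace.exp (τ • A) - 1 - τ • A‖ ≤ C * τ ^ 2 := by
  obtain ⟨C₀, hC₀⟩ := isCompact_Icc.exists_bound_of_continuousOn (s := Icc (0 : ℝ) 1)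
    (continuous_exp_smul A).continuousOn
  have hC₀0 : 0 ≤ C₀ := (norm_nonneg _).trans (hC₀ 0 (by simp))
  have h1 : ∀ τ ∈ Icc (0 : ℝ) 1, ‖NormedSpace.exp (τ • A) - 1‖ ≤ C₀ * ‖A‖ * τ := by
    intro τ hτ
    have := (convex_Icc (0 : ℝ) 1).norm_image_sub_le_of_norm_hasDerivWithin_le
      (fun t _ => (hasDerivAt_exp_smul_const (𝕂 := ℝ) A t).hasDerivWithinAt)
      (fun t ht => (norm_mul_le _ _).trans
        (mul_le_mul_of_nonneg_right (hC₀ t ht) (norm_nonneg A)))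
      (left_mem_Icc.2 zero_le_one) hτ
    rw [zero_smul, NormedSpace.exp_zero, sub_zero, Real.norm_of_nonneg hτ.1] at this
    exact this
  have h2 : ∀ τ ∈ Icc (0 : ℝ) 1,
      ‖NormedSpace.exp (τ • A) - 1 - τ • A‖ ≤ C₀ * ‖A‖ * ‖A‖ * τ ^ 2 := by
    intro τ hτ
    have hd : ∀ t ∈ Icc (0 : ℝ) τ, HasDerivWithinAt
        (fun t : ℝ => NormedSpace.exp (t • A) - t • A)
        (NormedSpace.exp (t • A) * A - (1 : ℝ) • A) (Icc 0 τ) t := fun t _ =>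
      ((hasDerivAt_exp_smul_const (𝕂 := ℝ) A t).sub
        ((hasDerivAt_id t).smul_const A)).hasDerivWithinAt
    have := (convex_Icc (0 : ℝ) τ).norm_image_sub_le_of_norm_hasDerivWithin_le
      (C := C₀ * ‖A‖ * τ * ‖A‖) hd ?_ (left_mem_Icc.2 hτ.1) (right_mem_Icc.2 hτ.1)
    · simp only [zero_smul, NormedSpace.exp_zero, sub_zero, Real.norm_eq_abs,
        abs_of_nonneg hτ.1] at this
      calc _ = ‖NormedSpace.exp (τ • A) - τ • A - 1‖ := by congr 1; abel
        _ ≤ _ := this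
        _ = _ := by ring
    · intro t ht
      have e : NormedSpace.exp (t • A) * A - (1 : ℝ) • A = (NormedSpace.exp (t • A) - 1) * A := by
        rw [sub_mul, one_mul, one_smul]
      rw [e]
      refine (norm_mul_le _ _).trans (mul_le_mul_of_nonneg_right ?_ (norm_nonneg A))
      refine (h1 t ⟨ht.1, ht.2.trans hτ.2⟩).trans ?_
      gcongr
      exact ht.2
  refine ⟨C₀ + C₀ * ‖A‖ + C₀ * ‖A‖ * ‖A‖ + 1, by positivity, fun τ hτ => ⟨?_, ?_, ?_⟩⟩
  · have : 0 ≤ C₀ * ‖A‖ + C₀ * ‖A‖ * ‖A‖ + 1 := by positivity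
    linarith [hC₀ τ hτ]
  · refine (h1 τ hτ).trans (mul_le_mul_of_nonneg_right ?_ hτ.1)
    have : 0 ≤ C₀ + C₀ * ‖A‖ * ‖A‖ + 1 := by positivity
    linarith
  · refine (h2 τ hτ).trans (mul_le_mul_of_nonneg_right ?_ (sq_nonneg τ))
    have : 0 ≤ C₀ + C₀ * ‖A‖ + 1 := by positivity
    linarith

theorem intervalIntegral_matrix_apply {n : ℕ} {g : ℝ → Matrix (Fin n) (Fin n) ℝ}
    (hg : Continuous g) (a b : ℝ) (i j : Fin n) :
    (∫ τ in a..b, g τ) i j = ∫ τ in a..b, g τ i j :=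
  ((LinearMap.toContinuousLinearMap (Matrix.entryLinearMap ℝ ℝ i j)).intervalIntegral_comp_comm
    (hg.intervalIntegrable a b)).symm

/-- Second differences of an admissible disturbance with step `T` are `O(T ^ 2)`. -/
theorem DisturbanceBound.norm_second_diff_le {m : ℕ} {D : ℝ} {f : ℝ → Fin m → ℝ}
    (hf : DisturbanceBound D f) {T t : ℝ} (hT : 0 ≤ T) (ht : 0 ≤ t) :
    ‖f (t + 2 * T) - (2 : ℝ) • f (t + T) + f t‖ ≤ D * T ^ 2 := by
  obtain ⟨v, w, h⟩ := hf
  have hv : ∀ s, 0 ≤ s → ‖v (s + T) - v s‖ ≤ D * T := by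
    intro s hs
    have := (convex_Ici (0 : ℝ)).norm_image_sub_le_of_norm_hasDerivWithin_le
      (fun x hx => (h x hx).2.1) (fun x hx => (h x hx).2.2.2.2)
      (mem_Ici.2 hs) (mem_Ici.2 (add_nonneg hs hT))
    simpa [abs_of_nonneg hT] using this
  have hd : ∀ s ∈ Ici (0 : ℝ), HasDerivWithinAt (fun s => f (s + T) - f s)
      (v (s + T) - v s) (Ici 0) s := by
    intro s hs
    have h1 := (h (s + T) (add_nonneg hs hT)).1.scomp s
      ((hasDerivAt_id s).add_const T).hasDerivWithinAt
      (fun x hx => add_nonneg (mem_Ici.1 hx) hT : MapsTo (fun x => id x + T) (Ici 0) (Ici 0))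
    rw [one_smul] at h1
    exact h1.sub (h s hs).1
  have := (convex_Ici (0 : ℝ)).norm_image_sub_le_of_norm_hasDerivWithin_le hd
    (fun x hx => hv x hx) (mem_Ici.2 ht) (mem_Ici.2 (add_nonneg ht hT))
  have e : f (t + 2 * T) - (2 : ℝ) • f (t + T) + f t =
      f (t + T + T) - f (t + T) - (f (t + T) - f t) := by
    rw [show t + 2 * T = t + T + T by ring]; module
  rw [e]
  refine this.trans (le_of_eq ?_)
  simp [abs_of_nonneg hT]; ring

namespace SMCData

variable {q m p : ℕ} (S : SMCData q m p)

theorem exists_norm_Abar_sub_le :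
    ∃ C : ℝ, 0 < C ∧ ∀ T, 0 < T → T ≤ 1 → ‖S.Abar T - S.A‖ ≤ C * T := by
  obtain ⟨C, hC, h⟩ := exp_smul_estimates S.A
  refine ⟨C, hC, fun T hT hT1 => ?_⟩
  have e : S.Abar T - S.A = T⁻¹ • (NormedSpace.exp (T • S.A) - 1 - T • S.A) := by
    rw [Abar, Phi, smul_sub _ _ (T • S.A), inv_smul_smul₀ hT.ne']
  rw [e, norm_smul, Real.norm_of_nonneg (by positivity)]
  calc _ ≤ T⁻¹ * (C * T ^ 2) := by gcongr; exact (h T ⟨hT.le, hT1⟩).2.2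
    _ = C * T := by field_simp

theorem exists_norm_Bbar_sub_le :
    ∃ C : ℝ, 0 < C ∧ ∀ T, 0 < T → T ≤ 1 → ‖S.Bbar T - S.B‖ ≤ C * T := by
  obtain ⟨C, hC, h⟩ := exp_smul_estimates S.A
  refine ⟨C * (‖S.B‖ + 1), by positivity, fun T hT hT1 => ?_⟩
  have hc := continuous_exp_smul S.A
  have hΓ : S.Gam T = (∫ τ in (0 : ℝ)..T, NormedSpace.exp (τ • S.A)) * S.B := by
    rw [Gam]
    congr 1
    ext i j
    rw [intervalIntegral_matrix_apply hc]
    rfl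
  have hI : ∫ τ in (0 : ℝ)..T, (NormedSpace.exp (τ • S.A) - 1) =
      (∫ τ in (0 : ℝ)..T, NormedSpace.exp (τ • S.A)) - T • 1 := by
    rw [intervalIntegral.integral_sub (hc.intervalIntegrable _ _)
      (continuous_const.intervalIntegrable _ _), intervalIntegral.integral_const, sub_zero]
  have e : S.Bbar T - S.B =
      T⁻¹ • ((∫ τ in (0 : ℝ)..T, (NormedSpace.exp (τ • S.A) - 1)) * S.B) := by
    rw [hI, Bbar, hΓ, Matrix.sub_mul, smul_sub, Matrix.smul_mul, Matrix.one_mul,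
      inv_smul_smul₀ hT.ne']
  have hb : ‖∫ τ in (0 : ℝ)..T, (NormedSpace.exp (τ • S.A) - 1)‖ ≤ C * T * |T - 0| := by
    refine intervalIntegral.norm_integral_le_of_norm_le_const fun τ hτ => ?_
    rw [uIoc_of_le hT.le] at hτ
    exact (h τ ⟨hτ.1.le, hτ.2.trans hT1⟩).2.1.trans (by gcongr; exact hτ.2)
  rw [sub_zero, abs_of_pos hT] at hb
  rw [e, norm_smul, Real.norm_of_nonneg (by positivity)]
  calc _ ≤ T⁻¹ * (C * T * T * (‖S.B‖ + 1)) := by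
        gcongr
        refine (Matrix.linfty_opNorm_mul _ _).trans ?_
        gcongr
        linarith
    _ = _ := by field_simp

/-- The sampled disturbance is `O(T)`, its image under `M` is `O(T ^ 2)` because `M B = 0` allows
`exp (τ A)` to be replaced by `exp (τ A) - 1`, and its second differences are `O(T ^ 3)`. -/
theorem exists_dist_bounds (hMB : S.M * S.B = 0) :
    ∃ C : ℝ, 0 < C ∧ ∀ T, 0 < T → T ≤ 1 → ∀ (D : ℝ) (f : ℝ → Fin m → ℝ),
      DisturbanceBound D f → ∀ k, ‖S.dist f T k‖ ≤ C * T * D ∧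
        ‖S.M *ᵥ S.dist f T k‖ ≤ C * T ^ 2 * D ∧
        ‖S.dist f T (k + 2) - (2 : ℝ) • S.dist f T (k + 1) + S.dist f T k‖ ≤ C * T ^ 3 * D := by
  obtain ⟨C, hC, h⟩ := exp_smul_estimates S.A
  refine ⟨C * (‖S.M‖ + 1) * (‖S.B‖ + 1), by positivity, fun T hT hT1 D f hf k => ?_⟩
  have hD : 0 ≤ D := by
    obtain ⟨v, w, hvw⟩ := hf
    exact (norm_nonneg _).trans (hvw 0 le_rfl).2.2.1
  have hfD : ∀ t, 0 ≤ t → ‖f t‖ ≤ D := by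
    obtain ⟨v, w, hvw⟩ := hf
    exact fun t ht => (hvw t ht).2.2.1
  have hfc : ContinuousOn f (Ici 0) := by
    obtain ⟨v, w, hvw⟩ := hf
    exact fun t ht => (hvw t ht).1.continuousWithinAt
  have hpos : ∀ (k : ℕ) (τ : ℝ), τ ≤ T → 0 ≤ ((k : ℝ) + 1) * T - τ := by
    intro k τ hτ
    have : 0 ≤ (k : ℝ) * T := by positivity
    linarith
  have hint : ∀ k : ℕ, IntervalIntegrable
      (fun τ => (NormedSpace.exp (τ • S.A) * S.B) *ᵥ f (((k : ℝ) + 1) * T - τ))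
      MeasureTheory.volume 0 T := by
    intro k
    apply ContinuousOn.intervalIntegrable
    rw [uIcc_of_le hT.le]
    have hm : Continuous fun z : Matrix (Fin (q + m)) (Fin m) ℝ × (Fin m → ℝ) => z.1 *ᵥ z.2 :=
      continuous_fst.matrix_mulVec continuous_snd
    refine hm.comp_continuousOn (ContinuousOn.prodMk ?_ ?_)
    · exact ((continuous_exp_smul S.A).matrix_mul continuous_const).continuousOn
    · exact hfc.comp (by fun_prop) fun τ hτ => hpos k τ hτ.2
  have hexp : ∀ τ ∈ uIoc 0 T, ‖NormedSpace.exp (τ • S.A) * S.B‖ ≤ C * (‖S.B‖ + 1) := by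
    intro τ hτ
    rw [uIoc_of_le hT.le] at hτ
    refine (Matrix.linfty_opNorm_mul _ _).trans ?_
    gcongr
    · exact (h τ ⟨hτ.1.le, hτ.2.trans hT1⟩).1
    · linarith
  have hle : ∀ τ ∈ uIoc 0 T, τ ≤ T := fun τ hτ => by
    rw [uIoc_of_le hT.le] at hτ; exact hτ.2
  have hM1 : 1 ≤ ‖S.M‖ + 1 := by linarith [norm_nonneg S.M]
  have hCB : C * (‖S.B‖ + 1) ≤ C * (‖S.M‖ + 1) * (‖S.B‖ + 1) := by
    gcongr; exact le_mul_of_one_le_right hC.le hM1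
  refine ⟨?_, ?_, ?_⟩
  · have : ‖S.dist f T k‖ ≤ C * (‖S.B‖ + 1) * D * |T - 0| := by
      refine intervalIntegral.norm_integral_le_of_norm_le_const fun τ hτ => ?_
      refine (Matrix.linfty_opNorm_mulVec _ _).trans ?_
      gcongr
      · exact hexp τ hτ
      · exact hfD _ (hpos k τ (hle τ hτ))
    rw [sub_zero, abs_of_pos hT] at this
    calc _ ≤ _ := this
      _ ≤ C * (‖S.M‖ + 1) * (‖S.B‖ + 1) * D * T := by gcongr
      _ = _ := by ring
  · have e : S.M *ᵥ S.dist f T k = ∫ τ in (0 : ℝ)..T,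
        (S.M * (NormedSpace.exp (τ • S.A) - 1) * S.B) *ᵥ f (((k : ℝ) + 1) * T - τ) := by
      have := (LinearMap.toContinuousLinearMap (Matrix.mulVecLin S.M)).intervalIntegral_comp_comm
        (hint k)
      refine this.symm.trans (intervalIntegral.integral_congr fun τ _ => ?_)
      simp only [LinearMap.coe_toContinuousLinearMap', Matrix.mulVecLin_apply,
        Matrix.mulVec_mulVec]
      rw [Matrix.mul_sub, Matrix.mul_one, Matrix.sub_mul, hMB, sub_zero, Matrix.mul_assoc]
    have : ‖S.M *ᵥ S.dist f T k‖ ≤ (‖S.M‖ + 1) * (C * T) * (‖S.B‖ + 1) * D * |T - 0| := by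
      rw [e]
      refine intervalIntegral.norm_integral_le_of_norm_le_const fun τ hτ => ?_
      refine (Matrix.linfty_opNorm_mulVec _ _).trans ?_
      gcongr
      · refine (Matrix.linfty_opNorm_mul _ _).trans ?_
        gcongr
        · refine (Matrix.linfty_opNorm_mul _ _).trans ?_
          gcongr
          · linarith
          · rw [uIoc_of_le hT.le] at hτ
            exact (h τ ⟨hτ.1.le, hτ.2.trans hT1⟩).2.1.trans (by gcongr; exact hτ.2)
        · linarith
      · exact hfD _ (hpos k τ (hle τ hτ))
    rw [sub_zero, abs_of_pos hT] at this
    exact this.trans (le_of_eq (by ring))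
  · have e : S.dist f T (k + 2) - (2 : ℝ) • S.dist f T (k + 1) + S.dist f T k =
        ∫ τ in (0 : ℝ)..T, (NormedSpace.exp (τ • S.A) * S.B) *ᵥ
          (f (((k : ℝ) + 1) * T - τ + 2 * T) - (2 : ℝ) • f (((k : ℝ) + 1) * T - τ + T)
            + f (((k : ℝ) + 1) * T - τ)) := by
      have hint2 : IntervalIntegrable (fun τ => (2 : ℝ) •
          ((NormedSpace.exp (τ • S.A) * S.B) *ᵥ f ((((k + 1 : ℕ) : ℝ) + 1) * T - τ)))
          MeasureTheory.volume 0 T := (hint (k + 1)).smul (2 : ℝ)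
      unfold dist
      rw [← intervalIntegral.integral_smul,
        ← intervalIntegral.integral_sub (hint (k + 2)) hint2,
        ← intervalIntegral.integral_add ((hint (k + 2)).sub hint2) (hint k)]
      refine intervalIntegral.integral_congr fun τ _ => ?_
      simp only [Matrix.mulVec_add, Matrix.mulVec_sub, Matrix.mulVec_smul]
      push_cast
      rw [show ((k : ℝ) + 2 + 1) * T - τ = ((k : ℝ) + 1) * T - τ + 2 * T by ring,
        show ((k : ℝ) + 1 + 1) * T - τ = ((k : ℝ) + 1) * T - τ + T by ring]
    have : ‖S.dist f T (k + 2) - (2 : ℝ) • S.dist f T (k + 1) + S.dist f T k‖ ≤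
        C * (‖S.B‖ + 1) * (D * T ^ 2) * |T - 0| := by
      rw [e]
      refine intervalIntegral.norm_integral_le_of_norm_le_const fun τ hτ => ?_
      refine (Matrix.linfty_opNorm_mulVec _ _).trans ?_
      gcongr
      · exact hexp τ hτ
      · exact hf.norm_second_diff_le hT.le (hpos k τ (hle τ hτ))
    rw [sub_zero, abs_of_pos hT] at this
    calc _ ≤ _ := this
      _ ≤ C * (‖S.M‖ + 1) * (‖S.B‖ + 1) * (D * T ^ 2) * T := by gcongr
      _ = _ := by ring

end SMCData

end MatrixNorm

/-! ### An adapted norm for the reduced-order motion, and the change of coordinates -/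

section MatrixNorm

open Filter Topology

attribute [local instance] Matrix.linftyOpNormedAddCommGroup Matrix.linftyOpNormedSpace
  Matrix.linftyOpNormedRing Matrix.linftyOpNormedAlgebra

theorem exists_norm_one_add_smul_lt {s : Set ℂ} (hs : s.Finite) (h : ∀ z ∈ s, z.re < 0) :
    ∃ t : ℝ, 0 < t ∧ ∀ z ∈ s, ‖1 + (t : ℂ) * z‖ < 1 := by
  have hz : ∀ z ∈ s, ∀ᶠ t : ℝ in 𝓝[>] 0, ‖1 + (t : ℂ) * z‖ < 1 := by
    intro z hz
    have hlim : Tendsto (fun t : ℝ => 2 * z.re + t * Complex.normSq z) (𝓝[>] 0)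
        (𝓝 (2 * z.re + 0 * Complex.normSq z)) := by
      refine Tendsto.mono_left ?_ nhdsWithin_le_nhds
      exact (by fun_prop : Continuous fun t : ℝ => 2 * z.re + t * Complex.normSq z).tendsto 0
    have := hlim.eventually_lt_const (u := 0) (by linarith [h z hz])
    filter_upwards [this, self_mem_nhdsWithin] with t ht ht0
    rw [Set.mem_Ioi] at ht0
    have e : ‖1 + (t : ℂ) * z‖ ^ 2 = 1 + t * (2 * z.re + t * Complex.normSq z) := by
      rw [Complex.sq_norm, Complex.normSq_apply, Complex.normSq_apply]
      simp; ring
    have : ‖1 + (t : ℂ) * z‖ ^ 2 < 1 ^ 2 := by rw [e]; nlinarith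
    exact lt_of_pow_lt_pow_left₀ 2 zero_le_one this
  obtain ⟨t, ht, ht0⟩ := (((hs.eventually_all).2 hz).and self_mem_nhdsWithin).exists
  exact ⟨t, ht0, ht⟩

theorem norm_eq_norm_map_complex {q : ℕ} (E : Matrix (Fin q) (Fin q) ℝ) :
    ‖E‖ = ‖E.map (algebraMap ℝ ℂ)‖ := by
  simp [Matrix.linfty_opNorm_def]

/-- If `A` is stable, then for some `t > 0` the matrix `1 + t A` has spectral radius below one, and
hence a power of small norm by Gelfand's formula over `ℂ`. -/
theorem exists_norm_pow_le_half {q : ℕ} (A : Matrix (Fin q) (Fin q) ℝ)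
    (h : ∀ z ∈ spectrum ℂ (A.map (algebraMap ℝ ℂ)), z.re < 0) :
    ∃ t : ℝ, 0 < t ∧ ∃ n : ℕ, 0 < n ∧ ‖(1 + t • A) ^ n‖ ≤ 1 / 2 := by
  rcases Nat.eq_zero_or_pos q with rfl | hq
  · refine ⟨1, one_pos, 1, one_pos, ?_⟩
    rw [Subsingleton.elim ((1 + (1 : ℝ) • A) ^ 1) 0, norm_zero]
    norm_num
  have : Nonempty (Fin q) := ⟨⟨0, hq⟩⟩
  obtain ⟨t, ht, hlt⟩ := exists_norm_one_add_smul_lt (Matrix.finite_spectrum _) h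
  refine ⟨t, ht, ?_⟩
  set A' := A.map (algebraMap ℝ ℂ) with hA'
  set E : Matrix (Fin q) (Fin q) ℂ := 1 + (t : ℂ) • A' with hE
  have hspec : ∀ z ∈ spectrum ℂ E, ‖z‖₊ < 1 := by
    intro z hz
    have e : E = Polynomial.aeval A' (1 + Polynomial.C (t : ℂ) * Polynomial.X) := by
      simp [hE, Algebra.smul_def]
    rw [e, spectrum.map_polynomial_aeval_of_nonempty _ _ (spectrum.nonempty A')] at hz
    obtain ⟨w, hw, rfl⟩ := hz
    have := hlt w hw
    rw [← NNReal.coe_lt_coe]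
    simpa using this
  have hr := spectrum.spectralRadius_lt_of_forall_lt E hspec
  have hg := spectrum.pow_nnnorm_pow_one_div_tendsto_nhds_spectralRadius E
  obtain ⟨r, hr1, hr2⟩ := ENNReal.lt_iff_exists_nnreal_btwn.1 hr
  have hrlt : r < 1 := by exact_mod_cast hr2
  have hpow : Tendsto (fun n : ℕ => (r : ℝ) ^ n) atTop (𝓝 0) :=
    tendsto_pow_atTop_nhds_zero_of_lt_one r.2 (by exact_mod_cast hrlt)
  obtain ⟨n, ⟨hn1, hn2⟩, hn3⟩ := (((hg.eventually_lt_const hr1).and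
    (hpow.eventually_le_const (show (0 : ℝ) < 1 / 2 by norm_num))).and
      (eventually_gt_atTop 0)).exists
  refine ⟨n, hn3, ?_⟩
  have hmap : ((1 + t • A) ^ n).map (algebraMap ℝ ℂ) = E ^ n := by
    have h1 : (1 + t • A).map (algebraMap ℝ ℂ) = E := by
      ext i j
      by_cases hij : i = j <;> simp [hE, hA', hij]
    have h2 := map_pow (algebraMap ℝ ℂ).mapMatrix (1 + t • A) n
    simp only [RingHom.mapMatrix_apply] at h2
    rw [h2, h1]
  rw [norm_eq_norm_map_complex, hmap]
  have hn0 : (0 : ℝ) < n := by exact_mod_cast hn3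
  have h3 : ‖E ^ n‖₊ ≤ r ^ n := by
    have h4 : ((‖E ^ n‖₊ : ENNReal) ^ (1 / n : ℝ)) ^ (n : ℝ) ≤ (r : ENNReal) ^ (n : ℝ) :=
      ENNReal.rpow_le_rpow hn1.le hn0.le
    rw [← ENNReal.rpow_mul, one_div_mul_cancel hn0.ne', ENNReal.rpow_one,
      ENNReal.rpow_natCast] at h4
    exact_mod_cast h4
  exact le_trans (by exact_mod_cast h3) hn2

/-- For a stable matrix `A` there is a norm `V` equivalent to the given one that `1 + T A` contracts
by a factor `1 - c T`, for all small `T`. With `E = 1 + t A` and `‖E ^ n‖ ≤ 1 / 2`, it is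
`V x = ∑ k < n, ‖E ^ k x‖`; of the norm axioms only subadditivity is recorded. -/
theorem exists_adapted_norm {q : ℕ} (A : Matrix (Fin q) (Fin q) ℝ)
    (h : ∀ z ∈ spectrum ℂ (A.map (algebraMap ℝ ℂ)), z.re < 0) :
    ∃ (V : (Fin q → ℝ) → ℝ) (t c κ : ℝ), 0 < t ∧ 0 < c ∧ 0 < κ ∧
      (∀ x, ‖x‖ ≤ V x) ∧ (∀ x, V x ≤ κ * ‖x‖) ∧ (∀ x y, V (x + y) ≤ V x + V y) ∧
      ∀ T, 0 ≤ T → T ≤ t → ∀ x, V (x + T • A *ᵥ x) ≤ (1 - c * T) * V x := by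
  obtain ⟨t, ht, n, hn, hE⟩ := exists_norm_pow_le_half A h
  set E := 1 + t • A with hEdef
  set V : (Fin q → ℝ) → ℝ := fun x => ∑ k ∈ Finset.range n, ‖(E ^ k) *ᵥ x‖ with hV
  obtain ⟨κ, hκ⟩ : ∃ κ, κ = 1 + ∑ k ∈ Finset.range n, ‖E ^ k‖ := ⟨_, rfl⟩
  have hκ0 : 0 < κ := by
    rw [hκ]; have : 0 ≤ ∑ k ∈ Finset.range n, ‖E ^ k‖ := by positivity
    linarith
  have hVle : ∀ x, V x ≤ κ * ‖x‖ := by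
    intro x
    calc V x ≤ ∑ k ∈ Finset.range n, ‖E ^ k‖ * ‖x‖ :=
          Finset.sum_le_sum fun k _ => Matrix.linfty_opNorm_mulVec _ _
      _ = (∑ k ∈ Finset.range n, ‖E ^ k‖) * ‖x‖ := (Finset.sum_mul _ _ _).symm
      _ ≤ _ := by gcongr; linarith
  have hleV : ∀ x, ‖x‖ ≤ V x := by
    intro x
    have := Finset.single_le_sum (f := fun k => ‖(E ^ k) *ᵥ x‖) (fun k _ => norm_nonneg _)
      (Finset.mem_range.2 hn)
    simpa using this
  have hVadd : ∀ x y, V (x + y) ≤ V x + V y := by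
    intro x y
    rw [hV]
    simp only [← Finset.sum_add_distrib, Matrix.mulVec_add]
    exact Finset.sum_le_sum fun k _ => norm_add_le _ _
  have hVsmul : ∀ (r : ℝ) x, 0 ≤ r → V (r • x) = r * V x := by
    intro r x hr
    simp only [hV, Matrix.mulVec_smul, norm_smul, Real.norm_of_nonneg hr, Finset.mul_sum]
  have hVE : ∀ x, V (E *ᵥ x) ≤ (1 - 1 / (2 * κ)) * V x := by
    intro x
    -- the sum telescopes
    have h1 : V (E *ᵥ x) + ‖x‖ = V x + ‖(E ^ n) *ᵥ x‖ := by
      have a1 := Finset.sum_range_succ (fun k => ‖(E ^ k) *ᵥ x‖) n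
      have a2 := Finset.sum_range_succ' (fun k => ‖(E ^ k) *ᵥ x‖) n
      simp only [hV, Matrix.mulVec_mulVec, ← pow_succ]
      rw [← a1, a2]
      simp
    have h2 : ‖(E ^ n) *ᵥ x‖ ≤ 1 / 2 * ‖x‖ :=
      (Matrix.linfty_opNorm_mulVec _ _).trans (by gcongr)
    have h3 : 1 / (2 * κ) * V x ≤ 1 / 2 * ‖x‖ := by
      calc _ ≤ 1 / (2 * κ) * (κ * ‖x‖) := by gcongr; exact hVle x
        _ = _ := by field_simp
    linarith
  refine ⟨V, t, 1 / (2 * κ) / t, κ, ht, by positivity, hκ0, hleV, hVle, hVadd, ?_⟩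
  intro T hT hTt x
  -- `1 + T A` is a convex combination of `1` and `E = 1 + t A`
  have e : x + T • A *ᵥ x = (1 - T / t) • x + (T / t) • (E *ᵥ x) := by
    rw [hEdef, Matrix.add_mulVec, Matrix.one_mulVec, Matrix.smul_mulVec, smul_add, smul_smul,
      div_mul_cancel₀ _ ht.ne']
    module
  have hTt1 : T / t ≤ 1 := (div_le_one ht).2 hTt
  have hTt0 : 0 ≤ T / t := by positivity
  calc V (x + T • A *ᵥ x) ≤ (1 - T / t) * V x + T / t * V (E *ᵥ x) := by
        rw [e]
        refine (hVadd _ _).trans ?_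
        rw [hVsmul _ _ (by linarith), hVsmul _ _ hTt0]
    _ ≤ (1 - T / t) * V x + T / t * ((1 - 1 / (2 * κ)) * V x) := by gcongr; exact hVE x
    _ = _ := by ring

end MatrixNorm

namespace SMCData

variable {q m p : ℕ} {S : SMCData q m p}

theorem P1_mulVec_castAdd (S : SMCData q m p) (x : Fin (q + m) → ℝ) (i : Fin q) :
    (S.P1 *ᵥ x) (Fin.castAdd m i) = (S.M *ᵥ x) i := by
  simp [P1, Matrix.mulVec, dotProduct, Matrix.submatrix_apply]

theorem P1_mulVec_natAdd (S : SMCData q m p) (x : Fin (q + m) → ℝ) (i : Fin m) :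
    (S.P1 *ᵥ x) (Fin.natAdd q i) = S.switching x i := by
  rw [switching, Matrix.mulVec_mulVec]
  simp [P1, Matrix.mulVec, dotProduct, Matrix.submatrix_apply]

/-- `P₁` is injective: a vector killed by `M` lies in the range of `B`, by dimension, and `H C` is
injective on that range. -/
theorem IsDesign.isUnit_P1 (hS : S.IsDesign) : IsUnit S.P1 := by
  have hBinj : Function.Injective S.B.mulVec := by
    intro y z hyz
    apply Matrix.mulVec_injective_iff_isUnit.2 hS.isUnit_HCB
    simp only [← Matrix.mulVec_mulVec]
    rw [show S.B *ᵥ y = S.B *ᵥ z from hyz]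
  -- `range B ⊆ ker M` and both have dimension `m`
  have hker : LinearMap.range S.B.mulVecLin = LinearMap.ker S.M.mulVecLin := by
    apply Submodule.eq_of_le_of_finrank_eq
    · rintro _ ⟨y, rfl⟩
      simp [Matrix.mulVec_mulVec, hS.mul_B]
    · have h1 := LinearMap.finrank_range_of_inj (f := S.B.mulVecLin) hBinj
      have h2 := S.M.mulVecLin.finrank_range_add_finrank_ker
      have h3 : Module.finrank ℝ (LinearMap.range S.M.mulVecLin) = q := hS.rank_M
      simp only [Module.finrank_fin_fun] at h1 h2
      omega
  rw [← Matrix.mulVec_injective_iff_isUnit]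
  have : Function.Injective S.P1.mulVecLin := by
    rw [← LinearMap.ker_eq_bot, LinearMap.ker_eq_bot']
    intro x hx
    have hx' : S.P1 *ᵥ x = 0 := hx
    have hM : S.M *ᵥ x = 0 := funext fun i => by
      rw [← P1_mulVec_castAdd, hx']; rfl
    have hs : S.switching x = 0 := funext fun i => by
      rw [← P1_mulVec_natAdd, hx']; rfl
    have hxk : x ∈ LinearMap.ker S.M.mulVecLin := hM
    rw [← hker] at hxk
    obtain ⟨y, rfl⟩ := hxk
    have : (S.H * S.C * S.B) *ᵥ y = (S.H * S.C * S.B) *ᵥ 0 := by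
      rw [Matrix.mulVec_zero, ← hs, switching, Matrix.mulVecLin_apply, Matrix.mulVec_mulVec,
        Matrix.mulVec_mulVec, Matrix.mul_assoc]
    rw [Matrix.mulVec_injective_iff_isUnit.2 hS.isUnit_HCB this, map_zero]
  exact this

/-- The state is recovered from the coordinates `ξ = M x` and `s = H C x`. -/
theorem IsDesign.eq_Q_add_R (hS : S.IsDesign) (x : Fin (q + m) → ℝ) :
    x = S.Q *ᵥ (S.M *ᵥ x) + S.R *ᵥ S.switching x := by
  have h1 : S.P1⁻¹ *ᵥ (S.P1 *ᵥ x) = x := by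
    rw [Matrix.mulVec_mulVec, Matrix.nonsing_inv_mul _
      ((Matrix.isUnit_iff_isUnit_det _).1 hS.isUnit_P1), Matrix.one_mulVec]
  conv_lhs => rw [← h1]
  ext i
  rw [Matrix.mulVec, dotProduct, Fin.sum_univ_add]
  simp only [P1_mulVec_castAdd, P1_mulVec_natAdd]
  rfl

end SMCData

/-! ### The closed loop in the coordinates `ξ`, `s` -/

namespace SMCData

section MatrixNorm

open Filter Topology

attribute [local instance] Matrix.linftyOpNormedAddCommGroup Matrix.linftyOpNormedSpace
  Matrix.linftyOpNormedRing Matrix.linftyOpNormedAlgebra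

variable {q m p : ℕ}

/-- Bounds, with a single constant `C` independent of the sampling period `T`, for all the sampled
matrices and disturbances that enter the closed loop. The norm of a matrix is its operator norm for
the sup norm of vectors. -/
structure SampledBounds (S : SMCData q m p) (C T : ℝ) : Prop where
  isUnit_gain : IsUnit (S.H * S.C * S.Bbar T)
  gain_inv : ‖(S.H * S.C * S.Bbar T)⁻¹‖ ≤ C
  M : ‖S.M‖ ≤ C
  HC : ‖S.H * S.C‖ ≤ C
  Q : ‖S.Q‖ ≤ C
  R : ‖S.R‖ ≤ C
  Abar : ‖S.Abar T‖ ≤ C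
  Bbar : ‖S.Bbar T‖ ≤ C
  M_Abar_Q : ‖S.M * S.Abar T * S.Q‖ ≤ C
  M_Abar_R : ‖S.M * S.Abar T * S.R‖ ≤ C
  HC_Abar_Q : ‖S.H * S.C * S.Abar T * S.Q‖ ≤ C
  Omega2 : ‖S.Omega2 T‖ ≤ C
  M_Abar_Q_sub : ‖S.M * S.Abar T * S.Q - S.Ac‖ ≤ C * T
  M_Bbar : ‖S.M * S.Bbar T‖ ≤ C * T
  dist : ∀ (D : ℝ) (f : ℝ → Fin m → ℝ), DisturbanceBound D f → ∀ k,
    ‖S.dist f T k‖ ≤ C * T * D ∧ ‖S.M *ᵥ S.dist f T k‖ ≤ C * T ^ 2 * D ∧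
    ‖S.dist f T (k + 2) - (2 : ℝ) • S.dist f T (k + 1) + S.dist f T k‖ ≤ C * T ^ 3 * D

/-- `H C B̄ → H C B` as `T → 0`, so the sampled gain is invertible for small `T`, with bounded
inverse. -/
theorem exists_gain_inv_bound {S : SMCData q m p} (hS : S.IsDesign) :
    ∃ T₀ C : ℝ, 0 < T₀ ∧ 0 < C ∧ ∀ T, 0 < T → T ≤ T₀ →
      IsUnit (S.H * S.C * S.Bbar T) ∧ ‖(S.H * S.C * S.Bbar T)⁻¹‖ ≤ C := by
  obtain ⟨Cb, hCb, hb⟩ := S.exists_norm_Bbar_sub_le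
  have hB : Tendsto S.Bbar (𝓝[>] 0) (𝓝 S.B) := by
    refine tendsto_iff_norm_sub_tendsto_zero.2 ?_
    have hlim : Tendsto (fun T : ℝ => Cb * T) (𝓝[>] 0) (𝓝 0) := by
      have := (continuous_const_mul Cb).tendsto 0
      rw [mul_zero] at this
      exact this.mono_left nhdsWithin_le_nhds
    refine squeeze_zero' (Eventually.of_forall fun _ => norm_nonneg _) ?_ hlim
    filter_upwards [Ioc_mem_nhdsGT (zero_lt_one (α := ℝ))] with T hT
    exact hb T hT.1 hT.2
  have hG : Tendsto (fun T => S.H * S.C * S.Bbar T) (𝓝[>] 0) (𝓝 (S.H * S.C * S.B)) :=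
    ((by fun_prop : Continuous fun X : Matrix (Fin (q + m)) (Fin m) ℝ =>
      S.H * S.C * X).tendsto S.B).comp hB
  obtain ⟨w, hw⟩ := hS.isUnit_HCB
  rw [← hw] at hG
  have h1 : ∀ᶠ T in 𝓝[>] 0, IsUnit (S.H * S.C * S.Bbar T) :=
    hG.eventually (Units.isOpen.mem_nhds w.isUnit)
  have h2 := (((NormedRing.inverse_continuousAt w).tendsto.comp hG).norm).eventually_lt_const
    (lt_add_one _)
  obtain ⟨T₀, hT₀, h⟩ := (mem_nhdsGT_iff_exists_Ioc_subset).1 (h1.and h2)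
  refine ⟨T₀, ‖Ring.inverse (w : Matrix (Fin m) (Fin m) ℝ)‖ + 1, hT₀, by positivity,
    fun T hT hTT => ⟨(h ⟨hT, hTT⟩).1, ?_⟩⟩
  rw [Matrix.nonsing_inv_eq_ringInverse]
  exact (h ⟨hT, hTT⟩).2.le

theorem exists_sampledBounds {S : SMCData q m p} (hS : S.IsDesign) :
    ∃ T₀ C : ℝ, 0 < T₀ ∧ T₀ ≤ 1 ∧ 1 ≤ C ∧ ∀ T, 0 < T → T ≤ T₀ → S.SampledBounds C T := by
  obtain ⟨T₀, Cg, hT₀, hCg, hg⟩ := exists_gain_inv_bound hS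
  obtain ⟨Ca, hCa, ha⟩ := S.exists_norm_Abar_sub_le
  obtain ⟨Cb, hCb, hb⟩ := S.exists_norm_Bbar_sub_le
  obtain ⟨Cd, hCd, hd⟩ := S.exists_dist_bounds hS.mul_B
  obtain ⟨N, hN⟩ : ∃ N, N = 1 + Cg + (‖S.A‖ + Ca) + (‖S.B‖ + Cb) + Cd + ‖S.M‖ + ‖S.H * S.C‖
    + ‖S.Q‖ + ‖S.R‖ := ⟨_, rfl⟩
  have n1 := norm_nonneg S.A
  have n2 := norm_nonneg S.B
  have n3 := norm_nonneg S.M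
  have n4 := norm_nonneg (S.H * S.C)
  have n5 := norm_nonneg S.Q
  have n6 := norm_nonneg S.R
  have hN1 : 1 ≤ N := by linarith
  have hN0 : 0 ≤ N := by linarith
  have hNle : N ≤ N ^ 3 := le_self_pow₀ hN1 (by norm_num)
  have hN2 : N ^ 2 ≤ N ^ 3 := pow_le_pow_right₀ hN1 (by norm_num)
  refine ⟨min T₀ 1, N ^ 3, by positivity, min_le_right _ _, one_le_pow₀ hN1, ?_⟩
  intro T hT hTle
  have hTT₀ : T ≤ T₀ := hTle.trans (min_le_left _ _)
  have hT1 : T ≤ 1 := hTle.trans (min_le_right _ _)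
  have hMN : ‖S.M‖ ≤ N := by linarith
  have hHCN : ‖S.H * S.C‖ ≤ N := by linarith
  have hQN : ‖S.Q‖ ≤ N := by linarith
  have hRN : ‖S.R‖ ≤ N := by linarith
  have hA' : ‖S.Abar T - S.A‖ ≤ N * T :=
    (ha T hT hT1).trans (mul_le_mul_of_nonneg_right (by linarith) hT.le)
  have hB' : ‖S.Bbar T - S.B‖ ≤ N * T :=
    (hb T hT hT1).trans (mul_le_mul_of_nonneg_right (by linarith) hT.le)
  have hAN : ‖S.Abar T‖ ≤ N := by
    have h1 := norm_add_le (S.Abar T - S.A) S.A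
    rw [sub_add_cancel] at h1
    have := ha T hT hT1
    have : Ca * T ≤ Ca := mul_le_of_le_one_right hCa.le hT1
    linarith
  have hBN : ‖S.Bbar T‖ ≤ N := by
    have h1 := norm_add_le (S.Bbar T - S.B) S.B
    rw [sub_add_cancel] at h1
    have := hb T hT hT1
    have : Cb * T ≤ Cb := mul_le_of_le_one_right hCb.le hT1
    linarith
  have mul3 : ∀ {a b c d : ℕ} (X : Matrix (Fin a) (Fin b) ℝ) (Y : Matrix (Fin b) (Fin c) ℝ)
      (Z : Matrix (Fin c) (Fin d) ℝ) {r : ℝ}, ‖X‖ ≤ N → 0 ≤ r → ‖Y‖ ≤ N * r → ‖Z‖ ≤ N →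
      ‖X * Y * Z‖ ≤ N ^ 3 * r := by
    intro a b c d X Y Z r hX hr hY hZ
    calc ‖X * Y * Z‖ ≤ ‖X‖ * ‖Y‖ * ‖Z‖ :=
          (Matrix.linfty_opNorm_mul _ _).trans
            (mul_le_mul_of_nonneg_right (Matrix.linfty_opNorm_mul _ _) (norm_nonneg _))
      _ ≤ N * (N * r) * N := by gcongr
      _ = _ := by ring
  have mul3' : ∀ {a b c d : ℕ} (X : Matrix (Fin a) (Fin b) ℝ) (Y : Matrix (Fin b) (Fin c) ℝ)
      (Z : Matrix (Fin c) (Fin d) ℝ), ‖X‖ ≤ N → ‖Y‖ ≤ N → ‖Z‖ ≤ N →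
      ‖X * Y * Z‖ ≤ N ^ 3 := by
    intro a b c d X Y Z hX hY hZ
    have := mul3 X Y Z hX zero_le_one (by rwa [mul_one]) hZ
    rwa [mul_one] at this
  refine
    { isUnit_gain := (hg T hT hTT₀).1
      gain_inv := ((hg T hT hTT₀).2.trans (by linarith)).trans hNle
      M := hMN.trans hNle
      HC := hHCN.trans hNle
      Q := hQN.trans hNle
      R := hRN.trans hNle
      Abar := hAN.trans hNle
      Bbar := hBN.trans hNle
      M_Abar_Q := mul3' _ _ _ hMN hAN hQN
      M_Abar_R := mul3' _ _ _ hMN hAN hRN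
      HC_Abar_Q := mul3' _ _ _ hHCN hAN hQN
      Omega2 := mul3' _ _ _ hHCN hAN hRN
      M_Abar_Q_sub := ?_
      M_Bbar := ?_
      dist := ?_ }
  · rw [Ac, ← Matrix.sub_mul, ← Matrix.mul_sub]
    exact mul3 _ _ _ hMN hT.le hA' hQN
  · have e : S.M * S.Bbar T = S.M * (S.Bbar T - S.B) := by
      rw [Matrix.mul_sub, hS.mul_B, sub_zero]
    rw [e]
    calc _ ≤ ‖S.M‖ * ‖S.Bbar T - S.B‖ := Matrix.linfty_opNorm_mul _ _
      _ ≤ N * (N * T) := by gcongr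
      _ = N ^ 2 * T := by ring
      _ ≤ _ := by gcongr
  · intro D f hf k
    have hD : 0 ≤ D := by
      obtain ⟨v, w, hvw⟩ := hf
      exact (norm_nonneg _).trans (hvw 0 le_rfl).2.2.1
    obtain ⟨h1, h2, h3⟩ := hd T hT hT1 D f hf k
    have hCN : Cd ≤ N ^ 3 := le_trans (by linarith) hNle
    exact ⟨h1.trans (by gcongr), h2.trans (by gcongr), h3.trans (by gcongr)⟩

variable {S : SMCData q m p} {f : ℝ → Fin m → ℝ} {T α : ℝ} {x : ℕ → Fin (q + m) → ℝ}
  {u : ℕ → Fin m → ℝ}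

/-- The perturbation `e[k] = T • (H C Ā Q) ξ[k] + H C d[k]` that acts on the switching function:
the coupling from `ξ = M x` and the sampled disturbance. -/
noncomputable def forcing (S : SMCData q m p) (f : ℝ → Fin m → ℝ) (T : ℝ)
    (x : ℕ → Fin (q + m) → ℝ) (k : ℕ) : Fin m → ℝ :=
  T • (S.H * S.C * S.Abar T * S.Q) *ᵥ (S.M *ᵥ x k) + (S.H * S.C) *ᵥ S.dist f T k

theorem Phi_eq (S : SMCData q m p) (hT : T ≠ 0) : S.Phi T = 1 + T • S.Abar T := by
  rw [Abar, smul_inv_smul₀ hT, add_sub_cancel]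

theorem Gam_eq (S : SMCData q m p) (hT : T ≠ 0) : S.Gam T = T • S.Bbar T := by
  rw [Bbar, smul_inv_smul₀ hT]

theorem switching_eq (S : SMCData q m p) (z : Fin (q + m) → ℝ) :
    S.switching z = (S.H * S.C) *ᵥ z := by
  rw [switching, Matrix.mulVec_mulVec]

/-- One step of the plant, seen through any output matrix `L`, in the coordinates `ξ` and `s`. -/
theorem IsClosedLoop.mulVec_succ (h : S.IsClosedLoop f T α x u) (hS : S.IsDesign) (hT : T ≠ 0)
    {l : ℕ} (L : Matrix (Fin l) (Fin (q + m)) ℝ) (k : ℕ) :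
    L *ᵥ x (k + 1) = L *ᵥ x k + T • (L * S.Abar T * S.Q) *ᵥ (S.M *ᵥ x k)
      + T • (L * S.Abar T * S.R) *ᵥ S.switching (x k) + T • (L * S.Bbar T) *ᵥ u k
      + L *ᵥ S.dist f T k := by
  have hA : (L * S.Abar T) *ᵥ x k = (L * S.Abar T * S.Q) *ᵥ (S.M *ᵥ x k)
      + (L * S.Abar T * S.R) *ᵥ S.switching (x k) := by
    conv_lhs => rw [hS.eq_Q_add_R (x k)]
    simp only [Matrix.mulVec_add, Matrix.mulVec_mulVec, Matrix.mul_assoc]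
  rw [h.state, S.Phi_eq hT, S.Gam_eq hT, Matrix.mulVec_add, Matrix.mulVec_add, Matrix.add_mulVec,
    Matrix.one_mulVec, Matrix.mulVec_add, Matrix.smul_mulVec, Matrix.smul_mulVec,
    Matrix.mulVec_smul, Matrix.mulVec_smul, Matrix.mulVec_mulVec, Matrix.mulVec_mulVec, hA]
  module

theorem IsClosedLoop.switching_succ (h : S.IsClosedLoop f T α x u) (hS : S.IsDesign) (hT : T ≠ 0)
    (k : ℕ) : S.switching (x (k + 1)) = S.switching (x k)
      + T • S.Omega2 T *ᵥ S.switching (x k) + T • (S.H * S.C * S.Bbar T) *ᵥ u k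
      + S.forcing f T x k := by
  have := h.mulVec_succ hS hT (S.H * S.C) k
  rw [← switching_eq, ← switching_eq] at this
  rw [this, forcing, Omega2]
  module

/-- The control law without past values of `u` and `s`: past inputs are recovered from the
plant equation, which turns them into past perturbations. -/
theorem IsClosedLoop.control_eq (h : S.IsClosedLoop f T α x u) (hS : S.IsDesign) (hT : T ≠ 0)
    (hG : IsUnit (S.H * S.C * S.Bbar T)) (k : ℕ) :
    u (k + 2) = -((S.H * S.C * S.Bbar T)⁻¹ *ᵥ (((1 - α) / T) • S.switching (x (k + 2))
      + S.Omega2 T *ᵥ S.switching (x (k + 2))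
      + T⁻¹ • ((2 : ℝ) • S.forcing f T x (k + 1) - S.forcing f T x k))) := by
  have hu : ∀ k, u k = (S.H * S.C * S.Bbar T)⁻¹ *ᵥ (T⁻¹ • (S.switching (x (k + 1))
      - S.switching (x k) - T • S.Omega2 T *ᵥ S.switching (x k) - S.forcing f T x k)) := by
    intro k
    have e : S.switching (x (k + 1)) - S.switching (x k)
        - T • S.Omega2 T *ᵥ S.switching (x k) - S.forcing f T x k
        = T • (S.H * S.C * S.Bbar T) *ᵥ u k := by
      rw [h.switching_succ hS hT k]; abel
    rw [e, inv_smul_smul₀ hT, Matrix.mulVec_mulVec, Matrix.nonsing_inv_mul _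
      ((Matrix.isUnit_iff_isUnit_det _).1 hG), Matrix.one_mulVec]
  rw [h.control k, hu k, hu (k + 1), ← Matrix.mulVec_smul, ← Matrix.mulVec_smul,
    ← Matrix.mulVec_neg, ← Matrix.mulVec_neg, ← Matrix.mulVec_add, ← Matrix.mulVec_sub]
  congr 1
  simp only [Matrix.add_mulVec, Matrix.smul_mulVec, Matrix.one_mulVec]
  match_scalars <;> field_simp <;> ring

/-- In closed loop the switching function is a contraction driven by second differences of the
perturbation. -/
theorem IsClosedLoop.switching_recursion (h : S.IsClosedLoop f T α x u) (hS : S.IsDesign)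
    (hT : T ≠ 0) (hG : IsUnit (S.H * S.C * S.Bbar T)) (k : ℕ) :
    S.switching (x (k + 3)) = α • S.switching (x (k + 2))
      + (S.forcing f T x (k + 2) - (2 : ℝ) • S.forcing f T x (k + 1) + S.forcing f T x k) := by
  rw [h.switching_succ hS hT (k + 2), h.control_eq hS hT hG k, Matrix.mulVec_neg,
    Matrix.mulVec_mulVec, Matrix.mul_nonsing_inv _ ((Matrix.isUnit_iff_isUnit_det _).1 hG),
    Matrix.one_mulVec]
  match_scalars <;> field_simp <;> ring

end MatrixNorm

end SMCData

/-! ### Size estimates along closed-loop trajectories -/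

namespace SMCData

section MatrixNorm

attribute [local instance] Matrix.linftyOpNormedAddCommGroup Matrix.linftyOpNormedSpace
  Matrix.linftyOpNormedRing Matrix.linftyOpNormedAlgebra

variable {q m p : ℕ} {S : SMCData q m p} {f : ℝ → Fin m → ℝ} {T α C D : ℝ}
  {x : ℕ → Fin (q + m) → ℝ} {u : ℕ → Fin m → ℝ}

theorem norm_mulVec_le_of_le {a b : ℕ} {X : Matrix (Fin a) (Fin b) ℝ} {r : ℝ} (h : ‖X‖ ≤ r)
    (z : Fin b → ℝ) : ‖X *ᵥ z‖ ≤ r * ‖z‖ :=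
  (Matrix.linfty_opNorm_mulVec _ _).trans (mul_le_mul_of_nonneg_right h (norm_nonneg _))

theorem SampledBounds.norm_forcing_le (hb : S.SampledBounds C T) (hC : 1 ≤ C) (hT : 0 < T)
    (hf : DisturbanceBound D f) (k : ℕ) :
    ‖S.forcing f T x k‖ ≤ T * (C * ‖S.M *ᵥ x k‖ + C ^ 2 * D) := by
  refine (norm_add_le _ _).trans ?_
  have h1 := norm_mulVec_le_of_le hb.HC_Abar_Q (S.M *ᵥ x k)
  have h2 := norm_mulVec_le_of_le hb.HC (S.dist f T k)
  have h3 := (hb.dist D f hf k).1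
  rw [norm_smul, Real.norm_of_nonneg hT.le]
  calc _ ≤ T * (C * ‖S.M *ᵥ x k‖) + C * (C * T * D) := by gcongr; exact h2.trans (by gcongr)
    _ = _ := by ring

theorem IsClosedLoop.norm_control_le (h : S.IsClosedLoop f T α x u) (hS : S.IsDesign)
    (hb : S.SampledBounds C T) (hC : 1 ≤ C) (hT : 0 < T) (hf : DisturbanceBound D f)
    {β₁ : ℝ} (hα : α ≤ 1) (hβ : (1 - α) / T ≤ β₁) (k : ℕ) :
    ‖u (k + 2)‖ ≤ C * ((β₁ + C) * ‖S.switching (x (k + 2))‖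
      + 2 * (C * ‖S.M *ᵥ x (k + 1)‖ + C ^ 2 * D) + (C * ‖S.M *ᵥ x k‖ + C ^ 2 * D)) := by
  rw [h.control_eq hS hT.ne' hb.isUnit_gain, norm_neg]
  refine (norm_mulVec_le_of_le hb.gain_inv _).trans ?_
  gcongr
  refine (norm_add_le _ _).trans ?_
  have h1 : ‖((1 - α) / T) • S.switching (x (k + 2)) + S.Omega2 T *ᵥ S.switching (x (k + 2))‖ ≤
      (β₁ + C) * ‖S.switching (x (k + 2))‖ := by
    refine (norm_add_le _ _).trans ?_
    rw [norm_smul, Real.norm_of_nonneg (div_nonneg (by linarith) hT.le), add_mul]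
    gcongr
    exact norm_mulVec_le_of_le hb.Omega2 _
  have h2 : ‖T⁻¹ • ((2 : ℝ) • S.forcing f T x (k + 1) - S.forcing f T x k)‖ ≤
      2 * (C * ‖S.M *ᵥ x (k + 1)‖ + C ^ 2 * D) + (C * ‖S.M *ᵥ x k‖ + C ^ 2 * D) := by
    rw [norm_smul, Real.norm_of_nonneg (by positivity)]
    calc _ ≤ T⁻¹ * (2 * (T * (C * ‖S.M *ᵥ x (k + 1)‖ + C ^ 2 * D))
          + T * (C * ‖S.M *ᵥ x k‖ + C ^ 2 * D)) := by
          gcongr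
          refine (norm_sub_le _ _).trans ?_
          rw [norm_smul, Real.norm_two]
          gcongr
          · exact hb.norm_forcing_le hC hT hf _
          · exact hb.norm_forcing_le hC hT hf _
      _ = _ := by field_simp
  linarith

theorem IsClosedLoop.norm_xi_sub_le (h : S.IsClosedLoop f T α x u) (hS : S.IsDesign)
    (hb : S.SampledBounds C T) (hT : 0 < T) (hf : DisturbanceBound D f) (k : ℕ) :
    ‖S.M *ᵥ x (k + 1) - S.M *ᵥ x k‖ ≤
      T * (C * ‖S.M *ᵥ x k‖ + C * ‖S.switching (x k)‖ + C * T * ‖u k‖ + C * T * D) := by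
  have e : S.M *ᵥ x (k + 1) - S.M *ᵥ x k = T • (S.M * S.Abar T * S.Q) *ᵥ (S.M *ᵥ x k)
      + T • (S.M * S.Abar T * S.R) *ᵥ S.switching (x k) + T • (S.M * S.Bbar T) *ᵥ u k
      + S.M *ᵥ S.dist f T k := by
    rw [h.mulVec_succ hS hT.ne' S.M k]; abel
  rw [e]
  refine (norm_add₄_le).trans ?_
  simp only [norm_smul, Real.norm_of_nonneg hT.le]
  have h1 := norm_mulVec_le_of_le hb.M_Abar_Q (S.M *ᵥ x k)
  have h2 := norm_mulVec_le_of_le hb.M_Abar_R (S.switching (x k))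
  have h3 := norm_mulVec_le_of_le hb.M_Bbar (u k)
  have h4 := (hb.dist D f hf k).2.1
  calc _ ≤ T * (C * ‖S.M *ᵥ x k‖) + T * (C * ‖S.switching (x k)‖) + T * (C * T * ‖u k‖)
        + C * T ^ 2 * D := by gcongr
    _ = _ := by ring

/-- The second difference of `ξ` is estimated by two increments, each of size `O(T)`; together with
the factor `T` of the coupling this gives the order `T ^ 2`. -/
theorem IsClosedLoop.norm_switching_le (h : S.IsClosedLoop f T α x u) (hS : S.IsDesign)
    (hb : S.SampledBounds C T) (hC : 1 ≤ C) (hT : 0 < T) (hf : DisturbanceBound D f)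
    (hα : 0 ≤ α) (k : ℕ) :
    ‖S.switching (x (k + 3))‖ ≤ α * ‖S.switching (x (k + 2))‖
      + C ^ 2 * T ^ 2 * (‖S.M *ᵥ x (k + 1)‖ + ‖S.M *ᵥ x k‖ + ‖S.switching (x (k + 1))‖
        + ‖S.switching (x k)‖) + 3 * C ^ 2 * T ^ 3 * (‖u (k + 1)‖ + ‖u k‖ + D) := by
  have hD : 0 ≤ D := by
    obtain ⟨v, w, hvw⟩ := hf
    exact (norm_nonneg _).trans (hvw 0 le_rfl).2.2.1
  rw [h.switching_recursion hS hT.ne' hb.isUnit_gain k]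
  refine (norm_add_le _ _).trans ?_
  rw [norm_smul, Real.norm_of_nonneg hα, add_assoc]
  gcongr
  have e : S.forcing f T x (k + 2) - (2 : ℝ) • S.forcing f T x (k + 1) + S.forcing f T x k =
      T • (S.H * S.C * S.Abar T * S.Q) *ᵥ ((S.M *ᵥ x (k + 2) - S.M *ᵥ x (k + 1))
        - (S.M *ᵥ x (k + 1) - S.M *ᵥ x k))
      + (S.H * S.C) *ᵥ
        (S.dist f T (k + 2) - (2 : ℝ) • S.dist f T (k + 1) + S.dist f T k) := by
    simp only [forcing, Matrix.mulVec_sub, Matrix.mulVec_add, Matrix.mulVec_smul]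
    module
  rw [e]
  refine (norm_add_le _ _).trans ?_
  rw [norm_smul, Real.norm_of_nonneg hT.le]
  have h1 := norm_mulVec_le_of_le hb.HC_Abar_Q ((S.M *ᵥ x (k + 2) - S.M *ᵥ x (k + 1))
        - (S.M *ᵥ x (k + 1) - S.M *ᵥ x k))
  have h2 := norm_mulVec_le_of_le hb.HC
    (S.dist f T (k + 2) - (2 : ℝ) • S.dist f T (k + 1) + S.dist f T k)
  have h3 := (hb.dist D f hf k).2.2
  have h4 := (norm_sub_le (S.M *ᵥ x (k + 2) - S.M *ᵥ x (k + 1))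
    (S.M *ᵥ x (k + 1) - S.M *ᵥ x k)).trans
      (add_le_add (h.norm_xi_sub_le hS hb hT hf (k + 1)) (h.norm_xi_sub_le hS hb hT hf k))
  have h5 := norm_nonneg (u k)
  have h6 := norm_nonneg (u (k + 1))
  refine (add_le_add (mul_le_mul_of_nonneg_left
    (h1.trans (mul_le_mul_of_nonneg_left h4 (by linarith))) hT.le)
    (h2.trans (mul_le_mul_of_nonneg_left h3 (by linarith)))).trans ?_
  have h7 : 0 ≤ 2 * C ^ 2 * T ^ 3 * (‖u (k + 1)‖ + ‖u k‖) := by positivity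
  linarith

/-- Closed-loop trajectories satisfy `DelayIneq`, with constants and an adapted norm `V` that depend
only on the plant and on `β₀`, `β₁`; the remaining estimates compare `x` with `ξ`, `s` and bound its
growth over one step. -/
theorem exists_delayIneq (hS : S.IsDesign) {β₀ : ℝ} (β₁ : ℝ) (hβ₀ : 0 < β₀) (hβ : β₀ ≤ β₁) :
    ∃ T₀ c C : ℝ, 0 < T₀ ∧ T₀ ≤ 1 ∧ 0 < c ∧ 1 ≤ C ∧
      (∀ T, 0 < T → T ≤ T₀ → IsUnit (S.H * S.C * S.Bbar T)) ∧
      ∃ V : (Fin q → ℝ) → ℝ, ∀ T α : ℝ, Admissible β₀ β₁ T₀ T α →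
      ∀ (D : ℝ) (f : ℝ → Fin m → ℝ) (x : ℕ → Fin (q + m) → ℝ) (u : ℕ → Fin m → ℝ),
      DisturbanceBound D f → S.IsClosedLoop f T α x u →
      DelayIneq c C T D (fun k => V (S.M *ᵥ x k)) (fun k => ‖S.switching (x k)‖)
          (fun k => ‖u k‖) ∧
        ∀ k, ‖x (k + 1)‖ ≤ C * (‖x k‖ + ‖u k‖ + D) ∧ V (S.M *ᵥ x k) ≤ C * ‖x k‖ ∧
          ‖S.switching (x k)‖ ≤ C * ‖x k‖ ∧
          ‖x k‖ ≤ C * (V (S.M *ᵥ x k) + ‖S.switching (x k)‖) ∧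
          ‖x k‖ ≤ C * (‖S.M *ᵥ x k‖ + ‖S.switching (x k)‖) := by
  obtain ⟨V, t, c₀, κ, ht, hc₀, hκ, hleV, hVle, hVadd, hV⟩ := exists_adapted_norm S.Ac hS.stable
  obtain ⟨T₀, B, hT₀, hT₀1, hB, hbd⟩ := exists_sampledBounds hS
  have hB0 : 0 < B := by linarith
  have hβ₁ : 0 < β₁ := by linarith
  obtain ⟨C, hC⟩ : ∃ C, C = (κ + β₁ + 3) * B ^ 3 := ⟨_, rfl⟩
  have hB3 : 1 ≤ B ^ 3 := one_le_pow₀ hB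
  have hB13 : B ≤ B ^ 3 := le_self_pow₀ hB (by norm_num)
  have hB23 : B ^ 2 ≤ B ^ 3 := pow_le_pow_right₀ hB (by norm_num)
  -- lower bounds for `C`, one for each coefficient that occurs
  have hκC : κ * B ≤ C := by
    rw [hC]
    calc κ * B ≤ κ * B ^ 3 := by gcongr
      _ ≤ _ := by gcongr; linarith
  have h3C : 3 * B ^ 3 ≤ C := by rw [hC]; gcongr; linarith
  have hβC : B * (β₁ + B) ≤ C := by
    rw [hC]
    calc B * (β₁ + B) = β₁ * B + B ^ 2 := by ring
      _ ≤ β₁ * B ^ 3 + B ^ 3 := by gcongr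
      _ = (β₁ + 1) * B ^ 3 := by ring
      _ ≤ _ := mul_le_mul_of_nonneg_right (by linarith) (by positivity)
  have hC1 : 1 ≤ C := by linarith
  have hC0 : 0 < C := by linarith
  refine ⟨min T₀ t, min c₀ β₀, C, by positivity, (min_le_left _ _).trans hT₀1, by positivity, hC1,
    fun T hT hTle => (hbd T hT (hTle.trans (min_le_left _ _))).isUnit_gain, V, ?_⟩
  intro T α hadm D f x u hf h
  have hT := hadm.T_pos
  have hT₀' : T ≤ T₀ := hadm.T_le.trans (min_le_left _ _)
  have hTt : T ≤ t := hadm.T_le.trans (min_le_right _ _)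
  have hT1 : T ≤ 1 := hT₀'.trans hT₀1
  have hb := hbd T hT hT₀'
  have hV0 : ∀ z, 0 ≤ V z := fun z => (norm_nonneg z).trans (hleV z)
  have hD : 0 ≤ D := by
    obtain ⟨v, w, hvw⟩ := hf
    exact (norm_nonneg _).trans (hvw 0 le_rfl).2.2.1
  have hx : ∀ k, ‖x k‖ ≤ C * (‖S.M *ᵥ x k‖ + ‖S.switching (x k)‖) := by
    intro k
    conv_lhs => rw [hS.eq_Q_add_R (x k)]
    refine (norm_add_le _ _).trans ?_
    have h1 := norm_mulVec_le_of_le hb.Q (S.M *ᵥ x k)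
    have h2 := norm_mulVec_le_of_le hb.R (S.switching (x k))
    have hBC : B ≤ C := by linarith
    calc _ ≤ B * (‖S.M *ᵥ x k‖ + ‖S.switching (x k)‖) := by linarith
      _ ≤ _ := by gcongr
  refine ⟨⟨fun k => hV0 _, fun k => norm_nonneg _, ?_, ?_, ?_⟩, fun k => ⟨?_, ?_, ?_, ?_, hx k⟩⟩
  · intro k
    refine (h.norm_control_le hS hb hB hT hf hadm.α_lt_one.le hadm.β_le k).trans ?_
    have a1 := hleV (S.M *ᵥ x (k + 1))
    have a0 := hleV (S.M *ᵥ x k)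
    have v1 := hV0 (S.M *ᵥ x (k + 1))
    have v0 := hV0 (S.M *ᵥ x k)
    have s2 := norm_nonneg (S.switching (x (k + 2)))
    calc _ ≤ B * ((β₁ + B) * ‖S.switching (x (k + 2))‖
          + 2 * (B * V (S.M *ᵥ x (k + 1)) + B ^ 2 * D) + (B * V (S.M *ᵥ x k) + B ^ 2 * D)) := by
          gcongr
      _ = (B * (β₁ + B)) * ‖S.switching (x (k + 2))‖ + (2 * B ^ 2) * V (S.M *ᵥ x (k + 1))
          + B ^ 2 * V (S.M *ᵥ x k) + 3 * B ^ 3 * D := by ring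
      _ ≤ C * ‖S.switching (x (k + 2))‖ + C * V (S.M *ᵥ x (k + 1)) + C * V (S.M *ᵥ x k)
          + C * D := by gcongr <;> linarith
      _ = _ := by ring
  · intro k
    have e : S.M *ᵥ x (k + 1) = (S.M *ᵥ x k + T • S.Ac *ᵥ (S.M *ᵥ x k))
        + (T • (S.M * S.Abar T * S.Q - S.Ac) *ᵥ (S.M *ᵥ x k)
        + T • (S.M * S.Abar T * S.R) *ᵥ S.switching (x k) + T • (S.M * S.Bbar T) *ᵥ u k
        + S.M *ᵥ S.dist f T k) := by
      rw [h.mulVec_succ hS hT.ne' S.M k, Matrix.sub_mulVec]; module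
    have h1 := norm_mulVec_le_of_le hb.M_Abar_Q_sub (S.M *ᵥ x k)
    have h2 := norm_mulVec_le_of_le hb.M_Abar_R (S.switching (x k))
    have h3 := norm_mulVec_le_of_le hb.M_Bbar (u k)
    have h4 := (hb.dist D f hf k).2.1
    have a0 := hleV (S.M *ᵥ x k)
    have v0 := hV0 (S.M *ᵥ x k)
    have hrem : ‖T • (S.M * S.Abar T * S.Q - S.Ac) *ᵥ (S.M *ᵥ x k)
        + T • (S.M * S.Abar T * S.R) *ᵥ S.switching (x k) + T • (S.M * S.Bbar T) *ᵥ u k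
        + S.M *ᵥ S.dist f T k‖ ≤ B * T * ‖S.switching (x k)‖
        + B * T ^ 2 * (V (S.M *ᵥ x k) + ‖S.switching (x k)‖ + ‖u k‖ + D) := by
      refine (norm_add₄_le).trans ?_
      simp only [norm_smul, Real.norm_of_nonneg hT.le]
      calc _ ≤ T * (B * T * ‖S.M *ᵥ x k‖) + T * (B * ‖S.switching (x k)‖) + T * (B * T * ‖u k‖)
            + B * T ^ 2 * D := by gcongr
        _ ≤ T * (B * T * V (S.M *ᵥ x k)) + T * (B * ‖S.switching (x k)‖) + T * (B * T * ‖u k‖)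
            + B * T ^ 2 * D := by gcongr
        _ ≤ T * (B * T * V (S.M *ᵥ x k)) + T * (B * ‖S.switching (x k)‖) + T * (B * T * ‖u k‖)
            + B * T ^ 2 * D + B * T ^ 2 * ‖S.switching (x k)‖ :=
              le_add_of_nonneg_right (by positivity)
        _ = _ := by ring
    rw [e]
    refine (hVadd _ _).trans ?_
    have h5 : V (S.M *ᵥ x k + T • S.Ac *ᵥ (S.M *ᵥ x k)) ≤
        (1 - min c₀ β₀ * T) * V (S.M *ᵥ x k) := by
      refine (hV T hT.le hTt _).trans ?_
      gcongr
      exact min_le_left _ _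
    have h6 := (hVle (T • (S.M * S.Abar T * S.Q - S.Ac) *ᵥ (S.M *ᵥ x k)
        + T • (S.M * S.Abar T * S.R) *ᵥ S.switching (x k) + T • (S.M * S.Bbar T) *ᵥ u k
        + S.M *ᵥ S.dist f T k)).trans (mul_le_mul_of_nonneg_left hrem hκ.le)
    have h7 : κ * (B * T * ‖S.switching (x k)‖
        + B * T ^ 2 * (V (S.M *ᵥ x k) + ‖S.switching (x k)‖ + ‖u k‖ + D)) ≤
        C * T * ‖S.switching (x k)‖
        + C * T ^ 2 * (V (S.M *ᵥ x k) + ‖S.switching (x k)‖ + ‖u k‖ + D) := by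
      calc _ = (κ * B) * T * ‖S.switching (x k)‖
            + (κ * B) * T ^ 2 * (V (S.M *ᵥ x k) + ‖S.switching (x k)‖ + ‖u k‖ + D) := by ring
        _ ≤ _ := by gcongr
    linarith
  · intro k
    refine (h.norm_switching_le hS hb hB hT hf hadm.α_pos.le k).trans ?_
    have a1 := hleV (S.M *ᵥ x (k + 1))
    have a0 := hleV (S.M *ᵥ x k)
    have v1 := hV0 (S.M *ᵥ x (k + 1))
    have v0 := hV0 (S.M *ᵥ x k)
    have hα : α ≤ 1 - min c₀ β₀ * T := by
      have h1 := hadm.β_ge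
      rw [le_div_iff₀ hT] at h1
      have h2 : min c₀ β₀ * T ≤ β₀ * T := by gcongr; exact min_le_right _ _
      linarith
    have h2C : B ^ 2 ≤ C := by linarith
    have h3C' : 3 * B ^ 2 ≤ C := by linarith
    gcongr
  · have e : x (k + 1) = x k + T • S.Abar T *ᵥ x k + T • S.Bbar T *ᵥ u k + S.dist f T k := by
      rw [h.state, S.Phi_eq hT.ne', S.Gam_eq hT.ne', Matrix.add_mulVec, Matrix.one_mulVec,
        Matrix.smul_mulVec, Matrix.smul_mulVec]
    have h1 := norm_mulVec_le_of_le hb.Abar (x k)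
    have h2 := norm_mulVec_le_of_le hb.Bbar (u k)
    have h3 := (hb.dist D f hf k).1
    rw [e]
    refine (norm_add₄_le).trans ?_
    simp only [norm_smul, Real.norm_of_nonneg hT.le]
    calc _ ≤ ‖x k‖ + 1 * (B * ‖x k‖) + 1 * (B * ‖u k‖) + B * 1 * D := by
          gcongr
          exact h3.trans (by gcongr)
      _ = (1 + B) * ‖x k‖ + B * ‖u k‖ + B * D := by ring
      _ ≤ C * ‖x k‖ + C * ‖u k‖ + C * D := by gcongr <;> linarith
      _ = _ := by ring
  · calc _ ≤ κ * ‖S.M *ᵥ x k‖ := hVle _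
      _ ≤ κ * (B * ‖x k‖) := by gcongr; exact norm_mulVec_le_of_le hb.M _
      _ = κ * B * ‖x k‖ := by ring
      _ ≤ _ := by gcongr
  · rw [switching_eq]
    refine (norm_mulVec_le_of_le hb.HC _).trans ?_
    have hBC : B ≤ C := by linarith
    gcongr
  · refine (hx k).trans ?_
    gcongr
    exact hleV _

end MatrixNorm

end SMCData

theorem theorem4 {q m p : ℕ} (hmp : m ≤ p) (hpn : p < q + m) (S : SMCData q m p)
    (hS : S.IsDesign) (β₀ β₁ D : ℝ) (hβ₀ : 0 < β₀) (hβ : β₀ ≤ β₁) :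
    ∃ Tmax : ℝ, 0 < Tmax ∧
      -- the control law is well defined
      (∀ T : ℝ, 0 < T → T ≤ Tmax → IsUnit (S.H * S.C * S.Bbar T)) ∧
      -- boundary layer of order `T ^ 2` on `s`, ultimate bound of order `T` on the state
      (∃ K : ℝ, 0 < K ∧ ∀ T α : ℝ, Admissible β₀ β₁ Tmax T α → ∀ ρ : ℝ, ∃ N : ℕ,
        ∀ (f : ℝ → Fin m → ℝ) (x : ℕ → Fin (q + m) → ℝ) (u : ℕ → Fin m → ℝ),
          DisturbanceBound D f → S.IsClosedLoop f T α x u → S.InitBound ρ x u →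
          ∀ k : ℕ, N ≤ k → ‖S.switching (x k)‖ ≤ K * T ^ 2 ∧ ‖x k‖ ≤ K * T) ∧
      -- the control input is `O(1)` when the initial data are `O(1)`
      (∀ ρ : ℝ, ∃ L : ℝ, 0 < L ∧ ∀ T α : ℝ, Admissible β₀ β₁ Tmax T α →
        ∀ (f : ℝ → Fin m → ℝ) (x : ℕ → Fin (q + m) → ℝ) (u : ℕ → Fin m → ℝ),
          DisturbanceBound D f → S.IsClosedLoop f T α x u → S.InitBound ρ x u →
          ∀ k : ℕ, ‖u k‖ ≤ L) := by
  obtain ⟨T₀, c, C, hT₀, hT₀1, hc, hC, hunit, V, hsys⟩ := S.exists_delayIneq hS β₁ hβ₀ hβ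
  have hC0 : 0 < C := by linarith
  obtain ⟨T₁, K, hT₁, hK, hT₁1, hbound⟩ := DelayIneq.exists_ultimate_bound hc hC0
  -- a positive bound for the disturbances, so that `D'` can absorb the decaying terms
  obtain ⟨D', hD'⟩ : ∃ D', D' = |D| + 1 := ⟨_, rfl⟩
  have hD'0 : 0 < D' := by rw [hD']; positivity
  have hDD' : D ≤ D' := by rw [hD']; linarith [le_abs_self D]
  have hweak : ∀ f : ℝ → Fin m → ℝ, DisturbanceBound D f → DisturbanceBound D' f := by
    rintro f ⟨v, w, h⟩
    refine ⟨v, w, fun t ht => ?_⟩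
    obtain ⟨h1, h2, h3, h4, h5⟩ := h t ht
    exact ⟨h1, h2, h3.trans hDD', h4.trans hDD', h5.trans hDD'⟩
  have hinit : ∀ ρ : ℝ, ∃ Y : ℝ, 0 ≤ Y ∧ ∀ T α : ℝ, Admissible β₀ β₁ (min T₀ T₁) T α →
      ∀ (f : ℝ → Fin m → ℝ) (x : ℕ → Fin (q + m) → ℝ) (u : ℕ → Fin m → ℝ),
      DisturbanceBound D f → S.IsClosedLoop f T α x u → S.InitBound ρ x u →
      ∀ k ≤ 4, V (S.M *ᵥ x k) ≤ Y ∧ ‖S.switching (x k)‖ ≤ Y := by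
    intro ρ
    obtain ⟨Y, hY, h⟩ := exists_initial_bound (C := 2 * C * C) (R := 2 * C * |ρ|) (D := D')
      (by positivity) (by positivity) hD'0.le 4
    refine ⟨C * Y, by positivity, fun T α hadm f x u hf hcl hi k hk => ?_⟩
    have hadm' : Admissible β₀ β₁ T₀ T α :=
      ⟨hadm.T_pos, hadm.T_le.trans (min_le_left _ _), hadm.α_pos, hadm.α_lt_one, hadm.β_ge,
        hadm.β_le⟩
    obtain ⟨hd, hx⟩ := hsys T α hadm' D' f x u (hweak f hf) hcl
    have hρ := le_abs_self ρ
    have hle : ∀ r : ℝ, r ≤ ρ → r ≤ 2 * C * |ρ| := fun r hr => by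
      have : |ρ| ≤ 2 * C * |ρ| := le_mul_of_one_le_left (abs_nonneg _) (by linarith)
      linarith
    have hCC : C ≤ 2 * C * C := by nlinarith
    have := h (fun k => ‖x k‖) (fun k => ‖u k‖) ?_ ?_ ?_ (hle _ hi.u_zero) (hle _ hi.u_one) k hk
    · obtain ⟨_, h2, h3, _⟩ := hx k
      exact ⟨h2.trans (by gcongr; exact this.1), h3.trans (by gcongr; exact this.1)⟩
    · intro k
      refine (hx k).1.trans ?_
      gcongr
    · intro k
      refine (hd.input k).trans ?_
      have x0 := (hx k).2.1
      have x1 := (hx (k + 1)).2.1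
      have x2 := (hx (k + 2)).2.2.1
      have hDC : D' ≤ C * D' := le_mul_of_one_le_left hD'0.le hC
      calc _ ≤ C * (C * ‖x (k + 2)‖ + C * ‖x (k + 1)‖ + C * ‖x k‖ + C * D') := by gcongr
        _ = C * C * (‖x (k + 2)‖ + ‖x (k + 1)‖ + ‖x k‖ + D') := by ring
        _ ≤ _ := by gcongr; linarith
    · refine (hx 0).2.2.2.2.trans ?_
      calc _ ≤ C * (|ρ| + |ρ|) := by
            gcongr
            · exact hi.xi_zero.trans hρ
            · exact hi.s_zero.trans hρ
        _ = _ := by ring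
  refine ⟨min T₀ T₁, by positivity, fun T hT hTle => hunit T hT (hTle.trans (min_le_left _ _)),
    ⟨2 * C * (K * D'), by positivity, ?_⟩, ?_⟩
  · intro T α hadm ρ
    obtain ⟨Y, hY, hYb⟩ := hinit ρ
    have hT := hadm.T_pos
    have hT1 : T ≤ 1 := hadm.T_le.trans ((min_le_left _ _).trans hT₀1)
    have hadm' : Admissible β₀ β₁ T₀ T α :=
      ⟨hadm.T_pos, hadm.T_le.trans (min_le_left _ _), hadm.α_pos, hadm.α_lt_one, hadm.β_ge,
        hadm.β_le⟩
    obtain ⟨N, hN⟩ := (hbound T hT (hadm.T_le.trans (min_le_right _ _)) D' Y hD'0 hY).2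
    refine ⟨N, fun f x u hf hcl hi k hk => ?_⟩
    obtain ⟨hd, hx⟩ := hsys T α hadm' D' f x u (hweak f hf) hcl
    obtain ⟨h1, h2⟩ := hN _ _ _ hd (hYb T α hadm f x u hf hcl hi) k hk
    have hTT : T ^ 2 ≤ T := by nlinarith
    refine ⟨h2.trans ?_, (hx k).2.2.2.1.trans ?_⟩
    · calc K * T ^ 2 * D' = 1 * (K * D') * T ^ 2 := by ring
        _ ≤ _ := by gcongr; linarith
    · calc _ ≤ C * (K * T * D' + K * T ^ 2 * D') := by gcongr
        _ ≤ C * (K * T * D' + K * T * D') := by gcongr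
        _ = _ := by ring
  · intro ρ
    obtain ⟨Y, hY, hYb⟩ := hinit ρ
    refine ⟨|ρ| + C * (3 * (K * (Y + D')) + D'), by positivity, ?_⟩
    intro T α hadm f x u hf hcl hi k
    have hT := hadm.T_pos
    have hadm' : Admissible β₀ β₁ T₀ T α :=
      ⟨hadm.T_pos, hadm.T_le.trans (min_le_left _ _), hadm.α_pos, hadm.α_lt_one, hadm.β_ge,
        hadm.β_le⟩
    obtain ⟨hd, -⟩ := hsys T α hadm' D' f x u (hweak f hf) hcl
    have hall := (hbound T hT (hadm.T_le.trans (min_le_right _ _)) D' Y hD'0 hY).1 _ _ _ hd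
      (hYb T α hadm f x u hf hcl hi)
    have hρ := le_abs_self ρ
    have hpos : 0 ≤ C * (3 * (K * (Y + D')) + D') := by positivity
    match k with
    | 0 => linarith [hi.u_zero]
    | 1 => linarith [hi.u_one]
    | k + 2 =>
      have h0 := (hall k).1
      have h1 := (hall (k + 1)).1
      have h2 := (hall (k + 2)).2
      have h3 : ‖u (k + 2)‖ ≤ C * (3 * (K * (Y + D')) + D') :=
        (hd.input k).trans (by gcongr; linarith)
      linarith [abs_nonneg ρ]
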